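/- Let $q\in\mathbb{C}$ with $0<|q|<1$, choose $\tau\in\mathbb{C}$ with $\operatorname{Im}\tau>0$ and $q=e^{2\pi i\tau}$, and put $q^{\lambda}:=e^{2\pi i\lambda\tau}$. Let $K=\mathbb{C}(\{z\})$ be the field of convergent Laurent series with the automorphism $\phi(z)=qz$, and for $n\ge 1$ let $K_n=\mathbb{C}(\{z^{1/n}\})\supseteq K$ with $\phi(z^{1/n})=q^{1/n}z^{1/n}$. A difference module over $K$ is a finite dimensional $K$-vector space $M$ with an additive bijection $\Phi:M\to M$ such that $\Phi(fm)=\phi(f)\Phi(m)$ for $f\in K$, $m\in M$; it is irreducible if $M\neq 0$ and $0$, $M$ are its only difference submodules. The slopes of $M$ are those of the Newton polygon (with respect to the order $v$ at $z=0$) of any monic operator $L=\Phi^m+\dots+a_1\Phi+a_0$, $a_0\ne0$, with $M\cong K[\Phi,\Phi^{-1}]/K[\Phi,\Phi^{-1}]L$, the sign being normalised so that $\Phi-a$ has slope $v(a)$; $M$ is pure if it has exactly one slope. For $n\ge1$, $t\in\mathbb{Z}$ with $\gcd(t,n)=1$, and $c\in\mathbb{C}^*$ with $|q|^{1/n}<|c|\le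 1$, let $E(cz^{t/n})$ be the one-dimensional difference module $K_ne$, $\Phi e=cz^{t/n}e$, over $K_n$, considered as a difference module over $K$. Then: 1. Every $E(cz^{t/n})$ is pure, irreducible and has slope $t/n$. 2. For fixed $t/n$ and $c_1,c_2$ as above, $E(c_1z^{t/n})\cong E(c_2z^{t/n})$ if and only if $c_1^n=c_2^n$. 3. Every irreducible difference module over $K$ is isomorphic to some $E(cz^{t/n})$ with $n,t,c$ as above. -/

import Mathlib

universe u v

noncomputable section

namespace QDiff

/-- A formal Laurent series over `ℂ` (its principal part is finite by definition) is convergent if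
it converges absolutely on some punctured disc around `0`. -/
def IsConvergent (f : LaurentSeries ℂ) : Prop :=
  ∃ r : ℝ, 0 < r ∧ Summable fun k : ℤ => ‖f.coeff k‖ * r ^ k

theorem IsConvergent.exists_forall {f : LaurentSeries ℂ} (hf : IsConvergent f) :
    ∃ r₀ : ℝ, 0 < r₀ ∧ ∀ r : ℝ, 0 < r → r ≤ r₀ → Summable fun k : ℤ => ‖f.coeff k‖ * r ^ k := by
  obtain ⟨r₀, h0, hs⟩ := hf
  refine ⟨r₀, h0, fun r hr hle => ?_⟩
  refine Summable.of_nonneg_of_le (fun k => by positivity) (fun k => ?_)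
    (hs.mul_right ((r / r₀) ^ f.order))
  by_cases hk : k < f.order
  · simp [HahnSeries.coeff_eq_zero_of_lt_order hk]
  · have h1 : (r / r₀) ^ k ≤ (r / r₀) ^ f.order :=
      zpow_le_zpow_right_of_le_one₀ (by positivity) ((div_le_one h0).2 hle) (not_lt.1 hk)
    have h2 : r ^ k = r₀ ^ k * (r / r₀) ^ k := by
      rw [← mul_zpow, mul_div_cancel₀ _ h0.ne']
    rw [h2, ← mul_assoc]
    exact mul_le_mul_of_nonneg_left h1 (by positivity)

theorem IsConvergent.single (m : ℤ) (a : ℂ) : IsConvergent (HahnSeries.single m a) := by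
  refine ⟨1, one_pos, summable_of_ne_finset_zero (s := {m}) fun k hk => ?_⟩
  rw [HahnSeries.coeff_single_of_ne (by simpa using hk)]
  simp

theorem IsConvergent.add {f g : LaurentSeries ℂ} (hf : IsConvergent f) (hg : IsConvergent g) :
    IsConvergent (f + g) := by
  obtain ⟨r, hr, hf⟩ := hf.exists_forall
  obtain ⟨s, hs, hg⟩ := hg.exists_forall
  have h0 : 0 < min r s := lt_min hr hs
  refine ⟨min r s, h0, Summable.of_nonneg_of_le (fun k => by positivity) (fun k => ?_)
    ((hf _ h0 (min_le_left _ _)).add (hg _ h0 (min_le_right _ _)))⟩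
  rw [← add_mul]
  exact mul_le_mul_of_nonneg_right (by simpa using norm_add_le _ _) (by positivity)

theorem IsConvergent.neg {f : LaurentSeries ℂ} (hf : IsConvergent f) : IsConvergent (-f) := by
  obtain ⟨r, hr, hf⟩ := hf
  exact ⟨r, hr, by simpa using hf⟩

theorem IsConvergent.mul {f g : LaurentSeries ℂ} (hf : IsConvergent f) (hg : IsConvergent g) :
    IsConvergent (f * g) := by
  obtain ⟨r, hr, hf⟩ := hf.exists_forall
  obtain ⟨s, hs, hg⟩ := hg.exists_forall
  have h0 : 0 < min r s := lt_min hr hs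
  replace hf := hf _ h0 (min_le_left _ _)
  replace hg := hg _ h0 (min_le_right _ _)
  set ρ := min r s
  have hF := hf.mul_of_nonneg hg (fun k => by positivity) (fun k => by positivity)
  have hn : ∀ x : ℤ × ℤ, 0 ≤ ‖f.coeff x.1‖ * ρ ^ x.1 * (‖g.coeff x.2‖ * ρ ^ x.2) :=
    fun x => by positivity
  refine ⟨ρ, h0, Summable.of_nonneg_of_le (fun k => by positivity) (fun k => ?_)
    (summable_of_sum_le (f := fun k : ℤ => ∑ x ∈ Finset.antidiagonal f.isPWO_support
      g.isPWO_support k, ‖f.coeff x.1‖ * ρ ^ x.1 * (‖g.coeff x.2‖ * ρ ^ x.2))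
      (c := ∑' x : ℤ × ℤ, ‖f.coeff x.1‖ * ρ ^ x.1 * (‖g.coeff x.2‖ * ρ ^ x.2))
      (fun k => Finset.sum_nonneg fun x _ => hn x) fun u => ?_)⟩
  · rw [HahnSeries.coeff_mul]
    refine (mul_le_mul_of_nonneg_right (norm_sum_le _ _) (by positivity)).trans ?_
    rw [Finset.sum_mul]
    refine Finset.sum_le_sum fun x hx => le_of_eq ?_
    have hx' : x.1 + x.2 = k := by
      simp only [Finset.mem_antidiagonal] at hx
      exact hx.2.2
    rw [← hx', zpow_add₀ h0.ne', norm_mul]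
    ring
  · rw [← Finset.sum_biUnion]
    · exact hF.sum_le_tsum _ fun x _ => hn x
    · intro k _ l _ hkl
      refine Finset.disjoint_left.2 fun x hx hx' => hkl ?_
      simp only [Finset.mem_antidiagonal] at hx hx'
      exact hx.2.2.symm.trans hx'.2.2


theorem IsConvergent.inv {f : LaurentSeries ℂ} (hf : IsConvergent f) : IsConvergent f⁻¹ := by
  by_cases h0 : f = 0
  · subst h0
    simpa using hf
  obtain ⟨r, hr, hs⟩ := hf
  set u : PowerSeries ℂ := f.powerSeriesPart with hu
  have hu0 : PowerSeries.constantCoeff u ≠ 0 := by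
    rw [← PowerSeries.coeff_zero_eq_constantCoeff_apply, hu, LaurentSeries.powerSeriesPart_coeff]
    simpa using HahnSeries.coeff_order_eq_zero.not.2 h0
  set a : ℂ := (PowerSeries.constantCoeff u)⁻¹ with ha
  have hfac : f⁻¹ = HahnSeries.single (-f.order) 1 * HahnSeries.ofPowerSeries ℤ ℂ u⁻¹ := by
    refine inv_eq_of_mul_eq_one_right ?_
    have h1 : (HahnSeries.ofPowerSeries ℤ ℂ u) * HahnSeries.ofPowerSeries ℤ ℂ u⁻¹ = 1 := by
      rw [← map_mul, PowerSeries.mul_inv_cancel _ hu0, map_one]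
    rw [hu, LaurentSeries.ofPowerSeries_powerSeriesPart] at h1
    rw [← h1]
    ring
  rw [hfac]
  refine (IsConvergent.single _ _).mul ?_
  -- the coefficients of `u` are bounded by a geometric progression
  obtain ⟨C, hC, hb⟩ : ∃ C : ℝ, 0 ≤ C ∧ ∀ k : ℕ, ‖a‖ * ‖PowerSeries.coeff k u‖ ≤ C * r⁻¹ ^ k := by
    refine ⟨‖a‖ * (r ^ (-f.order) * ∑' k : ℤ, ‖f.coeff k‖ * r ^ k), ?_, fun k => ?_⟩
    · have : 0 ≤ ∑' k : ℤ, ‖f.coeff k‖ * r ^ k := tsum_nonneg fun k => by positivity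
      positivity
    · have h1 := hs.le_tsum (f.order + k) (fun j _ => by positivity)
      rw [hu, LaurentSeries.powerSeriesPart_coeff, mul_assoc]
      refine mul_le_mul_of_nonneg_left ?_ (norm_nonneg _)
      have h2 : ‖f.coeff (f.order + k)‖ =
          r ^ (-f.order) * (‖f.coeff (f.order + k)‖ * r ^ (f.order + (k : ℤ))) * r⁻¹ ^ k := by
        rw [zpow_add₀ hr.ne', zpow_neg, zpow_natCast, inv_pow]
        field_simp
      rw [h2]
      gcongr
  set B : ℝ := r⁻¹ * (1 + C) with hB
  have hB0 : 0 < B := by positivity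
  have key : ∀ k : ℕ, ‖PowerSeries.coeff k u⁻¹‖ ≤ ‖a‖ * B ^ k := by
    intro k
    induction k using Nat.strong_induction_on with
    | _ k ih =>
      rw [PowerSeries.coeff_inv]
      split_ifs with hk
      · subst hk
        simp [ha]
      · rw [norm_mul, norm_neg]
        refine (mul_le_mul_of_nonneg_left (norm_sum_le _ _) (norm_nonneg _)).trans ?_
        rw [Finset.mul_sum, Finset.Nat.sum_antidiagonal_eq_sum_range_succ_mk, Finset.sum_range_succ']
        have hz : ‖(PowerSeries.constantCoeff u)⁻¹‖ * ‖if k - 0 < k then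
            (PowerSeries.coeff 0) u * (PowerSeries.coeff (k - 0)) u⁻¹ else 0‖ = 0 := by simp
        simp only [] at hz ⊢
        rw [hz, add_zero]
        have hstep : ∀ i ∈ Finset.range k, ‖(PowerSeries.constantCoeff u)⁻¹‖ *
            ‖if k - (i + 1) < k then (PowerSeries.coeff (i + 1)) u *
              (PowerSeries.coeff (k - (i + 1))) u⁻¹ else 0‖ ≤
            ‖a‖ * (r⁻¹ ^ k * (C * (1 + C) ^ (k - 1 - i))) := by
          intro i hi
          have hik : i < k := Finset.mem_range.1 hi
          rw [if_pos (by omega), norm_mul, ← mul_assoc, ← ha]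
          calc _ ≤ (C * r⁻¹ ^ (i + 1)) * (‖a‖ * B ^ (k - (i + 1))) :=
                mul_le_mul (hb _) (ih _ (by omega)) (norm_nonneg _) (by positivity)
            _ = _ := by
                have e : k = (i + 1) + (k - (i + 1)) := by omega
                have e' : k - 1 - i = k - (i + 1) := by omega
                rw [hB, mul_pow, e']
                conv_rhs => rw [e, pow_add]
                simp only [Nat.add_sub_cancel_left]
                ring
        refine (Finset.sum_le_sum hstep).trans ?_
        rw [← Finset.mul_sum, ← Finset.mul_sum, ← Finset.mul_sum,
          Finset.sum_range_reflect (fun j => (1 + C) ^ j) k]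
        have hg : C * ∑ j ∈ Finset.range k, (1 + C) ^ j = (1 + C) ^ k - 1 := by
          have := mul_geom_sum (1 + C) k
          simpa using this
        rw [hg, hB, mul_pow]
        gcongr
        linarith
  refine ⟨(2 * B)⁻¹, by positivity, ?_⟩
  have hinj : Function.Injective (fun k : ℕ => (k : ℤ)) := Nat.cast_injective
  rw [← hinj.summable_iff]
  · refine Summable.of_nonneg_of_le (fun k => mul_nonneg (norm_nonneg _) (zpow_nonneg (by positivity) _)) (fun k => ?_)
      ((summable_geometric_of_lt_one (r := (1 / 2 : ℝ)) (by norm_num) (by norm_num)).mul_left ‖a‖)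
    simp only [Function.comp, HahnSeries.ofPowerSeries_apply_coeff, zpow_natCast]
    have hB2 : 0 < (2 * B)⁻¹ := by positivity
    calc _ ≤ ‖a‖ * B ^ k * (2 * B)⁻¹ ^ k := by gcongr; exact key k
      _ = _ := by
        rw [mul_assoc, ← mul_pow]
        congr 2
        field_simp
  · intro k hk
    have : (HahnSeries.ofPowerSeries ℤ ℂ u⁻¹).coeff k = 0 := by
      rw [HahnSeries.ofPowerSeries_apply]
      refine HahnSeries.embDomain_of_notMem_range ?_
      rintro ⟨j, rfl⟩
      exact hk ⟨j, rfl⟩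
    rw [this]
    simp

/-- The field `K = ℂ({z})` of convergent Laurent series. -/
def ConvLaurent : Subfield (LaurentSeries ℂ) where
  carrier := {f | IsConvergent f}
  mul_mem' := IsConvergent.mul
  one_mem' := IsConvergent.single 0 1
  add_mem' := IsConvergent.add
  zero_mem' := by simpa using IsConvergent.single 0 0
  neg_mem' := IsConvergent.neg
  inv_mem' := fun _ h => IsConvergent.inv h

/-- The series `c z ^ t`. -/
def mono (t : ℤ) (c : ℂ) : ConvLaurent := ⟨HahnSeries.single t c, IsConvergent.single t c⟩

theorem mono_ne_zero (t : ℤ) (c : ℂˣ) : mono t c ≠ 0 := fun h =>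
  c.ne_zero (HahnSeries.single_eq_zero_iff.1 (congrArg Subtype.val h))

/-- The substitution `f(z) ↦ f(a z)` on formal Laurent series, for `a ≠ 0`. -/
def formalDilation (a : ℂˣ) : LaurentSeries ℂ →+* LaurentSeries ℂ where
  toFun f := ⟨fun k => (a : ℂ) ^ k * f.coeff k,
    f.isPWO_support.mono fun k hk h => hk (by simp [h])⟩
  map_one' := by
    ext k
    by_cases hk : k = 0 <;> simp [hk]
  map_zero' := by
    ext k
    simp
  map_add' f g := by
    ext k
    simp [mul_add]
  map_mul' f g := by
    ext k
    simp only [HahnSeries.coeff_mul, Finset.mul_sum]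
    refine Finset.sum_congr ?_ fun x hx => ?_
    · ext x
      simp [zpow_ne_zero _ a.ne_zero]
    · have hx' : x.1 + x.2 = k := by
        simp only [Finset.mem_antidiagonal] at hx
        exact hx.2.2
      rw [← hx', zpow_add₀ a.ne_zero]
      ring

theorem IsConvergent.dilation (a : ℂˣ) {f : LaurentSeries ℂ} (hf : IsConvergent f) :
    IsConvergent (formalDilation a f) := by
  obtain ⟨r, hr, hs⟩ := hf
  have ha : 0 < ‖(a : ℂ)‖ := norm_pos_iff.2 a.ne_zero
  refine ⟨r / ‖(a : ℂ)‖, by positivity, hs.congr fun k => ?_⟩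
  simp only [formalDilation, RingHom.coe_mk, MonoidHom.coe_mk, OneHom.coe_mk, norm_mul, norm_zpow,
    div_zpow]
  field_simp

/-- The automorphism `f(z) ↦ f(a z)` of `K = ℂ({z})`, for `a ≠ 0`. -/
def dilation (a : ℂˣ) : ConvLaurent ≃+* ConvLaurent where
  toFun f := ⟨formalDilation a f.1, f.2.dilation a⟩
  invFun f := ⟨formalDilation a⁻¹ f.1, f.2.dilation a⁻¹⟩
  left_inv f := by
    ext k
    simp [formalDilation, zpow_ne_zero _ a.ne_zero]
  right_inv f := by
    ext k
    simp [formalDilation, zpow_ne_zero _ a.ne_zero]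
  map_mul' f g := Subtype.ext (map_mul (formalDilation a) f.1 g.1)
  map_add' f g := Subtype.ext (map_add (formalDilation a) f.1 g.1)

/-- The substitution `f(z) ↦ f(w ^ n)` from formal Laurent series in `z` to those in `w`. -/
def formalRamification (n : ℕ) [NeZero n] : LaurentSeries ℂ →+* LaurentSeries ℂ :=
  HahnSeries.embDomainRingHom (AddMonoidHom.mulLeft (n : ℤ))
    (mul_right_injective₀ (Nat.cast_ne_zero.2 (NeZero.ne n)))
    (fun _ _ => mul_le_mul_iff_right₀ (Nat.cast_pos.2 (NeZero.pos n)))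

theorem formalRamification_coeff_mul (n : ℕ) [NeZero n] (f : LaurentSeries ℂ) (k : ℤ) :
    (formalRamification n f).coeff (n * k) = f.coeff k :=
  HahnSeries.embDomain_mk_coeff _ _

theorem formalRamification_coeff_of_not_dvd (n : ℕ) [NeZero n] (f : LaurentSeries ℂ) {k : ℤ}
    (hk : ¬ (n : ℤ) ∣ k) : (formalRamification n f).coeff k = 0 := by
  refine HahnSeries.embDomain_of_notMem_range ?_
  rintro ⟨j, rfl⟩
  exact hk ⟨j, rfl⟩

theorem IsConvergent.ramification (n : ℕ) [NeZero n] {f : LaurentSeries ℂ} (hf : IsConvergent f) :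
    IsConvergent (formalRamification n f) := by
  obtain ⟨r, hr, hs⟩ := hf
  have hinj : Function.Injective (fun k : ℤ => (n : ℤ) * k) :=
    mul_right_injective₀ (Nat.cast_ne_zero.2 (NeZero.ne n))
  refine ⟨r ^ ((n : ℝ)⁻¹), by positivity, ?_⟩
  rw [← hinj.summable_iff]
  · refine hs.congr fun k => ?_
    simp only [Function.comp, formalRamification_coeff_mul]
    rw [zpow_mul, zpow_natCast, Real.rpow_inv_natCast_pow hr.le (NeZero.ne n)]
  · intro k hk
    rw [formalRamification_coeff_of_not_dvd n f fun ⟨j, hj⟩ => hk ⟨j, hj.symm⟩]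
    simp

/-- The field `K_n = ℂ({z^{1/n}})`: convergent Laurent series in the variable `w = z^{1/n}`. -/
def KRoot (_n : ℕ) : Type := ConvLaurent

instance (n : ℕ) : Field (KRoot n) := inferInstanceAs (Field ConvLaurent)

/-- The identification of `ℂ({w})` with `K_n` coming from `w = z^{1/n}`. -/
def KRoot.equiv (n : ℕ) : ConvLaurent ≃+* KRoot n := RingEquiv.refl ConvLaurent

/-- The element `c z^{t/n} = c w ^ t` of `K_n`. -/
def rootMono (n : ℕ) (t : ℤ) (c : ℂ) : KRoot n := KRoot.equiv n (mono t c)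

/-- The inclusion `K → K_n`, `z ↦ w ^ n`. -/
def ramification (n : ℕ) [NeZero n] : ConvLaurent →+* KRoot n where
  toFun f := KRoot.equiv n ⟨formalRamification n f.1, f.2.ramification n⟩
  map_one' := Subtype.ext (map_one (formalRamification n))
  map_zero' := Subtype.ext (map_zero (formalRamification n))
  map_mul' f g := Subtype.ext (map_mul (formalRamification n) f.1 g.1)
  map_add' f g := Subtype.ext (map_add (formalRamification n) f.1 g.1)

instance (n : ℕ) [NeZero n] : Algebra ConvLaurent (KRoot n) :=
  (ramification n).toAlgebra

/-- `q^λ := e^{2πiλτ}`. -/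
def qPow (τ l : ℂ) : ℂˣ :=
  Units.mk0 (Complex.exp (2 * Real.pi * Complex.I * l * τ)) (Complex.exp_ne_zero _)

/-- The automorphism `φ` of `K_n` with `φ (z^{1/n}) = q^{1/n} z^{1/n}`. -/
def rootShift (τ : ℂ) (n : ℕ) : KRoot n ≃+* KRoot n :=
  ((KRoot.equiv n).symm.trans (dilation (qPow τ (1 / n)))).trans (KRoot.equiv n)

/-- On `K ⊆ K_n` the automorphism `φ` of `K_n` is `z ↦ q z`. -/
theorem rootShift_algebraMap {q : ℂˣ} {τ : ℂ}
    (hqτ : (q : ℂ) = Complex.exp (2 * Real.pi * Complex.I * τ)) (n : ℕ) [NeZero n]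
    (f : ConvLaurent) :
    rootShift τ n (algebraMap ConvLaurent (KRoot n) f) =
      algebraMap ConvLaurent (KRoot n) (dilation q f) := by
  have hq : (qPow τ (1 / n) : ℂ) ^ n = q := by
    have hn : (n : ℂ) ≠ 0 := Nat.cast_ne_zero.2 (NeZero.ne n)
    rw [hqτ, qPow, Units.val_mk0, ← Complex.exp_nat_mul]
    congr 1
    field_simp
  refine Subtype.ext (HahnSeries.ext (funext fun k => ?_))
  change (qPow τ (1 / n) : ℂ) ^ k * (formalRamification n f.1).coeff k =
    (formalRamification n (formalDilation q f.1)).coeff k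
  by_cases hk : (n : ℤ) ∣ k
  · obtain ⟨j, rfl⟩ := hk
    rw [formalRamification_coeff_mul, formalRamification_coeff_mul, zpow_mul, zpow_natCast, hq]
    rfl
  · rw [formalRamification_coeff_of_not_dvd n _ hk, formalRamification_coeff_of_not_dvd n _ hk,
      mul_zero]

/-- The convergent series `∑ k, f_{nk + i} z ^ k` attached to a convergent series `f`. -/
def residuePart (n : ℕ) [NeZero n] (i : ℕ) (f : ConvLaurent) : ConvLaurent :=
  ⟨HahnSeries.ofSuppBddBelow (fun k : ℤ => f.1.coeff (n * k + i)) (by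
    refine ⟨-(|f.1.order| + i), fun k hk => ?_⟩
    by_contra hlt
    refine hk (HahnSeries.coeff_eq_zero_of_lt_order ?_)
    have hn : (1 : ℤ) ≤ n := by exact_mod_cast NeZero.pos n
    have h1 := neg_abs_le f.1.order
    have h2 := abs_nonneg f.1.order
    have h3 : (0 : ℤ) ≤ i := by positivity
    nlinarith), by
    obtain ⟨r, hr, hs⟩ := f.2
    refine ⟨r ^ n, by positivity, ?_⟩
    have hinj : Function.Injective (fun k : ℤ => (n : ℤ) * k + i) := fun a b h =>
      mul_right_injective₀ (Nat.cast_ne_zero.2 (NeZero.ne n)) (add_right_cancel h)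
    refine ((hs.comp_injective hinj).mul_right (r ^ (-(i : ℤ)))).congr fun k => ?_
    simp only [Function.comp, HahnSeries.ofSuppBddBelow]
    rw [mul_assoc, ← zpow_add₀ hr.ne', add_neg_cancel_right, zpow_mul, zpow_natCast]⟩

/-- `K_n` is finite over `K`, spanned by `1, w, …, w ^ (n - 1)`. -/
instance (n : ℕ) [NeZero n] : Module.Finite ConvLaurent (KRoot n) := by
  refine Module.Finite.of_surjective
    (Fintype.linearCombination ConvLaurent (fun i : Fin n => rootMono n (i : ℕ) 1))
    fun f => ?_
  obtain ⟨f, rfl⟩ := (KRoot.equiv n).surjective f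
  refine ⟨fun i => residuePart n i f, ?_⟩
  rw [Fintype.linearCombination_apply]
  refine (KRoot.equiv n).symm.injective (Subtype.ext (HahnSeries.ext (funext fun k => ?_)))
  rw [map_sum, RingEquiv.symm_apply_apply]
  have hval : ∀ g : Fin n → ConvLaurent, (∑ i, g i).1 = ∑ i, (g i).1 := fun g =>
    map_sum ConvLaurent.subtype g Finset.univ
  rw [hval, HahnSeries.coeff_sum]
  have hterm : ∀ i : Fin n,
      ((KRoot.equiv n).symm (residuePart n i f • rootMono n (i : ℕ) 1)).1.coeff k =
      (formalRamification n (residuePart n i f).1).coeff (k - (i : ℕ)) := by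
    intro i
    have := HahnSeries.coeff_mul_single_add (r := (1 : ℂ))
      (x := formalRamification n (residuePart n i f).1) (a := k - (i : ℕ)) (b := ((i : ℕ) : ℤ))
    rw [sub_add_cancel, mul_one] at this
    exact this
  simp only [hterm]
  have hn : (0 : ℤ) < n := by exact_mod_cast NeZero.pos n
  have hm0 := Int.emod_nonneg k hn.ne'
  have hm1 := Int.emod_lt_of_pos k hn
  set i₀ : Fin n := ⟨(k % n).toNat, by omega⟩ with hi₀
  have hi₀' : ((i₀ : ℕ) : ℤ) = k % n := by simp [hi₀, hm0]
  rw [Finset.sum_eq_single i₀]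
  · have e : k - ((i₀ : ℕ) : ℤ) = n * (k / n) := by
      have := Int.mul_ediv_add_emod k n
      omega
    rw [e, formalRamification_coeff_mul]
    change f.1.coeff (n * (k / n) + ((i₀ : ℕ) : ℤ)) = _
    rw [← e, sub_add_cancel]
  · intro i _ hi
    refine formalRamification_coeff_of_not_dvd n _ fun hd => hi (Fin.ext ?_)
    have h1 : k % n = ((i : ℕ) : ℤ) % n := Int.emod_eq_emod_iff_emod_sub_eq_zero.2
      (Int.emod_eq_zero_of_dvd hd)
    have h2 : ((i : ℕ) : ℤ) % n = i := Int.emod_eq_of_lt (by positivity) (by exact_mod_cast i.2)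
    rw [h2] at h1
    omega
  · simp

/-! ### Difference modules over a difference field `(F, φ)` -/

/-- A difference module over the difference field `(F, φ)`: a finite dimensional vector space with
an additive bijection `Φ` such that `Φ (f m) = φ(f) Φ(m)`. -/
structure DifferenceModule {F : Type*} [Field F] (φ : F ≃+* F) where
  carrier : Type u
  [addCommGroup : AddCommGroup carrier]
  [module : Module F carrier]
  [finite : Module.Finite F carrier]
  Φ : carrier ≃+ carrier
  Φ_smul : ∀ (f : F) (m : carrier), Φ (f • m) = φ f • Φ m

attribute [instance] DifferenceModule.addCommGroup DifferenceModule.module DifferenceModule.finite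

namespace DifferenceModule

variable {F : Type*} [Field F] {φ : F ≃+* F}

/-- Two difference modules are isomorphic if there is a linear bijection commuting with `Φ`. -/
def Isomorphic (M : DifferenceModule.{u} φ) (N : DifferenceModule.{v} φ) : Prop :=
  ∃ e : M.carrier ≃ₗ[F] N.carrier, ∀ m, e (M.Φ m) = N.Φ (e m)

/-- A difference module is irreducible if it is nonzero and its only difference submodules
(subspaces `N` with `Φ(N) = N`) are `0` and itself. -/
def IsIrreducible (M : DifferenceModule.{u} φ) : Prop :=
  Nontrivial M.carrier ∧
    ∀ N : Submodule F M.carrier, (∀ m, M.Φ m ∈ N ↔ m ∈ N) → N = ⊥ ∨ N = ⊤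

end DifferenceModule

/-- The skew ring `F[Φ, Φ⁻¹]` of difference operators: finite sums `∑ aₖ Φ ^ k`, `k ∈ ℤ`, with
`Φ f = φ(f) Φ`. It is the skew group ring of `ℤ` for the action of `ℤ` on `F` by powers of `φ`. -/
def DiffOp {F : Type*} [Field F] (_φ : F ≃+* F) : Type _ :=
  SkewMonoidAlgebra F (Multiplicative ℤ)

namespace DiffOp

variable {F : Type*} [Field F] (φ : F ≃+* F)

/-- The action of `ℤ` (written multiplicatively) on `F` by the powers of `φ`. -/
abbrev zAction : MulSemiringAction (Multiplicative ℤ) F :=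
  MulSemiringAction.compHom F (zpowersHom (RingAut F) φ)

instance : Ring (DiffOp φ) :=
  letI := zAction φ
  inferInstanceAs (Ring (SkewMonoidAlgebra F (Multiplicative ℤ)))

/-- The operator `a Φ ^ k`. -/
def term (k : ℤ) (a : F) : DiffOp φ := SkewMonoidAlgebra.single (Multiplicative.ofAdd k) a

theorem term_mul_term (k l : ℤ) (a b : F) :
    term φ k a * term φ l b = term φ (k + l) (a * (φ ^ k : RingAut F) b) := by
  let _ := zAction φ
  exact SkewMonoidAlgebra.single_mul_single

/-- The operator `∑ aᵢ Φ ^ i` with the coefficients of the polynomial `∑ aᵢ T ^ i`. -/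
def ofPolynomial (p : Polynomial F) : DiffOp φ :=
  ∑ i ∈ p.support, term φ i (p.coeff i)

end DiffOp

namespace DifferenceModule

variable {F : Type*} [Field F] {φ : F ≃+* F}

/-- `M ≅ F[Φ, Φ⁻¹] / F[Φ, Φ⁻¹] L`: an additive bijection compatible with the scalars from `F`
and with `Φ`. The span is that of a left module, so it is the left ideal generated by `L`. -/
def IsPresentedBy (M : DifferenceModule.{u} φ) (L : DiffOp φ) : Prop :=
  ∃ e : (DiffOp φ ⧸ Submodule.span (DiffOp φ) {L}) ≃+ M.carrier,
    (∀ (f : F) x, e (DiffOp.term φ 0 f • x) = f • e x) ∧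
    ∀ x, e (DiffOp.term φ 1 1 • x) = M.Φ (e x)

end DifferenceModule

/-! ### Newton polygons and slopes over `K` -/

/-- The Newton polygon of `∑ aᵢ T ^ i ∈ K[T]`: the convex hull of the vertical half-lines above the
points `(i, v(aᵢ))` with `aᵢ ≠ 0`, where `v` is the order at `z = 0`. -/
def newtonPolygon (p : Polynomial ConvLaurent) : Set (ℝ × ℝ) :=
  convexHull ℝ {x | ∃ i : ℕ, p.coeff i ≠ 0 ∧ x.1 = i ∧ (((p.coeff i).1.order : ℤ) : ℝ) ≤ x.2}

/-- `l` is a slope of the Newton polygon of `p` if a non-vertical edge of it (more than one point)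
lies on a line `y + l x = b`. The sign is normalised so that `T - a` has slope `v(a)`; thus the
module `K e`, `Φ e = c z ^ t e`, has slope `t`. -/
def IsNewtonSlope (p : Polynomial ConvLaurent) (l : ℝ) : Prop :=
  ∃ b : ℝ, (∀ x ∈ newtonPolygon p, b ≤ x.2 + l * x.1) ∧
    {x ∈ newtonPolygon p | x.2 + l * x.1 = b}.Nontrivial

namespace DifferenceModule

variable {φ : ConvLaurent ≃+* ConvLaurent}

/-- The slopes of `M`: those of the Newton polygons of the monic operators
`L = Φ ^ m + ⋯ + a₁ Φ + a₀`, `a₀ ≠ 0`, with `M ≅ K[Φ, Φ⁻¹] / K[Φ, Φ⁻¹] L`. -/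
def slopes (M : DifferenceModule.{u} φ) : Set ℝ :=
  {l | ∃ p : Polynomial ConvLaurent, p.Monic ∧ p.coeff 0 ≠ 0 ∧
    M.IsPresentedBy (DiffOp.ofPolynomial φ p) ∧ IsNewtonSlope p l}

/-- `M` is pure if it has exactly one slope. -/
def IsPure (M : DifferenceModule.{u} φ) : Prop := ∃ l, M.slopes = {l}

end DifferenceModule

/-- The difference module `E(c z^{t/n})` over `K`, where `φ` is `z ↦ q z` with `q = e^{2πiτ}`: the
one-dimensional module `K_n e`, `Φ e = c z^{t/n} e`, over `K_n`, considered over `K`. The element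
`f e` is represented by `f`, so that `Φ f = φ(f) c z^{t/n}`. -/
def E (q : ℂˣ) (τ : ℂ) (hqτ : (q : ℂ) = Complex.exp (2 * Real.pi * Complex.I * τ))
    (n : ℕ) [NeZero n] (t : ℤ) (c : ℂˣ) : DifferenceModule.{0} (dilation q) where
  carrier := KRoot n
  Φ := (rootShift τ n).toAddEquiv.trans (AddAut.mulRight
    (Units.mk0 (rootMono n t c) (mono_ne_zero t c)))
  Φ_smul f m := by
    change rootShift τ n (f • m) * rootMono n t c = dilation q f • (rootShift τ n m * rootMono n t c)
    rw [Algebra.smul_def, map_mul, rootShift_algebraMap hqτ, Algebra.smul_def, mul_assoc]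

/-- The conditions on the data `(n, t, c)` of a module `E(c z^{t/n})`, besides `n ≥ 1` and `c ≠ 0`:
`(t, n) = 1` and `|q|^{1/n} < |c| ≤ 1`. -/
def IsAdmissible (q : ℂˣ) (n : ℕ) (t : ℤ) (c : ℂˣ) : Prop :=
  IsCoprime t (n : ℤ) ∧ ‖(q : ℂ)‖ ^ (1 / (n : ℝ)) < ‖(c : ℂ)‖ ∧ ‖(c : ℂ)‖ ≤ 1

end QDiff

end

/-! Write p = q^{1/n}. Everything about E(c z^{t/n}) comes from the order `KRoot.ord` on K_n,
measured in z^{1/n}. The shift φ preserves it, elements of K have orders divisible by n, and each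
application of Φ adds t. So the term a Φ^i f with a ∈ K has order n v(a) + ord f + t i, which is
congruent to ord f + t i mod n. Since t is prime to n, the orders of f, Φ f, …, Φ^{n-1} f are
distinct mod n. A vanishing sum attains its minimal order twice
(`KRoot.exists_ord_eq_of_sum_eq_zero`), so these n vectors form a K-basis for every f ≠ 0. This is
irreducibility.

The same argument gives the slope. In a monic relation of degree n killing f, the two terms of
minimal order must be those of index 0 and n, so the Newton polygon is one edge of slope t/n. To
apply this to every presentation, quotients by left ideals are translated into cyclic vectors and
back by division with remainder in K[Φ, Φ⁻¹].

For the classification with n and t fixed, evaluate an isomorphism at 1, apply Φ^n and compare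
lowest coefficients: c₁^n = q^k c₂^n for some k ∈ ℤ. The normalisation puts |c_i|^n in (|q|, 1],
which forces k = 0. Conversely, if c₁^n = c₂^n, a K-automorphism z^{1/n} ↦ ξ z^{1/n} carries one
module to the other.

An irreducible M is generated by any nonzero vector, whose annihilator contains a monic L with
nonzero constant term. It suffices to solve L f = 0 with f ≠ 0 in some E(c z^{t/n}): this gives a
nonzero map M → E(c z^{t/n}), an isomorphism by Schur's lemma. Take t/n to be the slope of the first
edge of the Newton polygon of L. After twisting, L has coefficients regular at 0 and a
characteristic polynomial P_c(x) = P_1(c x) with P_1(0) ≠ 0. Choosing c to be a root of P_1 of least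
modulus makes x = 1 a root of P_c and excludes x = p^k for k ≥ 1, because |p| < 1. The recursion for
a power series solution then never divides by zero. Its divisors P_c(p^k) tend to P_c(0) ≠ 0, so
they are bounded below and the solution converges (`exists_convergent_solution`). Finally,
multiplication by a power of z^{1/n} changes c by a power of p and moves it into the required
annulus. -/

noncomputable section

namespace QDiff

/-! ### Convergent solutions of q-difference equations -/

/-- The sequence with first term `1` defined by the linear recursion `f k = ∑ l < k, u k l * f l`. -/
def recursiveSeq (u : ℕ → ℕ → ℂ) : ℕ → ℂ
  | 0 => 1
  | k + 1 => ∑ l : Fin (k + 1), u (k + 1) l * recursiveSeq u l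

theorem recursiveSeq_zero (u : ℕ → ℕ → ℂ) : recursiveSeq u 0 = 1 := by
  rw [recursiveSeq]

theorem recursiveSeq_of_pos (u : ℕ → ℕ → ℂ) {k : ℕ} (hk : 0 < k) :
    recursiveSeq u k = ∑ l ∈ Finset.range k, u k l * recursiveSeq u l := by
  obtain ⟨k, rfl⟩ := Nat.exists_eq_add_of_lt hk
  rw [Nat.zero_add, recursiveSeq, Finset.sum_range]

/-- A discrete Gronwall estimate: the induction closes because C ∑_{j<k} (1 + C)^j = (1 + C)^k - 1.
Geometric decay of the kernel in k - l thus yields a geometric bound on the solution, that is, a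
positive radius of convergence. -/
theorem norm_recursiveSeq_le {u : ℕ → ℕ → ℂ} {C R : ℝ} (hC : 0 ≤ C) (hR : 0 ≤ R)
    (hu : ∀ k l, l < k → ‖u k l‖ ≤ C * R ^ (k - l)) (k : ℕ) :
    ‖recursiveSeq u k‖ ≤ (R * (1 + C)) ^ k := by
  induction k using Nat.strong_induction_on with
  | _ k ih =>
    rcases Nat.eq_zero_or_pos k with rfl | hk
    · simp [recursiveSeq_zero]
    rw [recursiveSeq_of_pos u hk]
    have hterm : ∀ l ∈ Finset.range k,
        ‖u k l * recursiveSeq u l‖ ≤ R ^ k * (C * (1 + C) ^ l) := by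
      intro l hl
      have hlk := Finset.mem_range.1 hl
      rw [norm_mul]
      refine (mul_le_mul (hu k l hlk) (ih l hlk) (norm_nonneg _) (by positivity)).trans_eq ?_
      have hRk : R ^ k = R ^ (k - l) * R ^ l := by rw [← pow_add, Nat.sub_add_cancel hlk.le]
      rw [mul_pow, hRk]
      ring
    refine (norm_sum_le _ _).trans ((Finset.sum_le_sum hterm).trans ?_)
    rw [← Finset.mul_sum, ← Finset.mul_sum, mul_pow]
    have hg : C * ∑ j ∈ Finset.range k, (1 + C) ^ j = (1 + C) ^ k - 1 := by
      simpa using mul_geom_sum (1 + C) k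
    rw [hg]
    gcongr
    linarith

theorem ofPowerSeries_coeff_of_neg (F : PowerSeries ℂ) {k : ℤ} (hk : k < 0) :
    (HahnSeries.ofPowerSeries ℤ ℂ F).coeff k = 0 := by
  rw [HahnSeries.ofPowerSeries_apply]
  refine HahnSeries.embDomain_of_notMem_range ?_
  rintro ⟨j, rfl⟩
  exact absurd hk (by simp)

theorem IsConvergent.ofPowerSeries {F : PowerSeries ℂ} {A B : ℝ}
    (h : ∀ k, ‖PowerSeries.coeff k F‖ ≤ A * B ^ k) :
    IsConvergent (HahnSeries.ofPowerSeries ℤ ℂ F) := by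
  have hA : 0 ≤ A := by simpa using (norm_nonneg _).trans (h 0)
  -- No sign is assumed for B; |B| + 1 is positive and still dominates.
  set B' : ℝ := |B| + 1 with hB'
  have hB0 : 0 < B' := by positivity
  refine ⟨(2 * B')⁻¹, by positivity, ?_⟩
  have hinj : Function.Injective (fun k : ℕ => (k : ℤ)) := Nat.cast_injective
  rw [← hinj.summable_iff]
  · refine Summable.of_nonneg_of_le
      (fun k => mul_nonneg (norm_nonneg _) (zpow_nonneg (by positivity) _)) (fun k => ?_)
      ((summable_geometric_of_lt_one (r := (1 / 2 : ℝ)) (by norm_num) (by norm_num)).mul_left A)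
    simp only [Function.comp, HahnSeries.ofPowerSeries_apply_coeff, zpow_natCast]
    have h1 : ‖PowerSeries.coeff k F‖ ≤ A * B' ^ k := by
      refine (h k).trans (mul_le_mul_of_nonneg_left ?_ hA)
      refine (le_abs_self _).trans ?_
      rw [abs_pow]
      gcongr
      linarith
    have hB2 : 0 < (2 * B')⁻¹ := by positivity
    calc _ ≤ A * B' ^ k * (2 * B')⁻¹ ^ k := by gcongr
      _ = _ := by
        rw [mul_assoc, ← mul_pow]
        congr 2
        field_simp
  · intro k hk
    have hneg : k < 0 := not_le.1 fun h => hk ⟨k.toNat, Int.toNat_of_nonneg h⟩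
    simp [ofPowerSeries_coeff_of_neg F hneg]

theorem IsConvergent.exists_coeff_bound {f : LaurentSeries ℂ} (hf : IsConvergent f) :
    ∃ A R : ℝ, 0 ≤ A ∧ 0 ≤ R ∧ ∀ k : ℕ, ‖f.coeff k‖ ≤ A * R ^ k := by
  obtain ⟨r, hr, hs⟩ := hf
  refine ⟨∑' k : ℤ, ‖f.coeff k‖ * r ^ k, r⁻¹, tsum_nonneg fun k => by positivity,
    by positivity, fun k => ?_⟩
  have h1 := hs.le_tsum (k : ℤ) (fun j _ => by positivity)
  rw [inv_pow, ← div_eq_mul_inv, le_div_iff₀ (by positivity)]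
  simpa using h1

/-- The constants of the individual series are added up, which serves as a maximum and also covers
the empty family. -/
theorem exists_uniform_coeff_bound (s : Finset ℕ) (b : ℕ → ConvLaurent) :
    ∃ A R : ℝ, 0 ≤ A ∧ 0 ≤ R ∧ ∀ i ∈ s, ∀ k : ℕ, ‖(b i).1.coeff k‖ ≤ A * R ^ k := by
  choose A R hA hR h using fun i => (b i).2.exists_coeff_bound
  refine ⟨∑ i ∈ s, A i, ∑ i ∈ s, R i, Finset.sum_nonneg fun i _ => hA i,
    Finset.sum_nonneg fun i _ => hR i, fun i hi k => (h i k).trans ?_⟩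
  have h1 := Finset.single_le_sum (fun j _ => hA j) hi
  have h2 := Finset.single_le_sum (fun j _ => hR j) hi
  exact mul_le_mul h1 (pow_le_pow_left₀ (hR i) h2 k) (pow_nonneg (hR i) k)
    (Finset.sum_nonneg fun i _ => hA i)

/-- There are no small divisors: P(p^k) → P(0) ≠ 0, so all but finitely many values have modulus at
least |P(0)|/2, and the remaining ones are nonzero. -/
theorem exists_lower_bound {P : Polynomial ℂ} {p : ℂ} (hp : ‖p‖ < 1) (h0 : P.eval 0 ≠ 0)
    (h : ∀ k : ℕ, 0 < k → P.eval (p ^ k) ≠ 0) :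
    ∃ δ : ℝ, 0 < δ ∧ ∀ k : ℕ, 0 < k → δ ≤ ‖P.eval (p ^ k)‖ := by
  have hlim : Filter.Tendsto (fun k : ℕ => ‖P.eval (p ^ k)‖) Filter.atTop
      (nhds ‖P.eval 0‖) :=
    ((P.continuous.tendsto 0).comp (tendsto_pow_atTop_nhds_zero_of_norm_lt_one hp)).norm
  have hev := hlim.eventually_const_le (half_lt_self (norm_pos_iff.2 h0))
  obtain ⟨N, hN⟩ := Filter.eventually_atTop.1 hev
  have hne : (insert (‖P.eval 0‖ / 2)
      ((Finset.Ico 1 N).image fun k => ‖P.eval (p ^ k)‖)).Nonempty := Finset.insert_nonempty _ _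
  refine ⟨Finset.min' _ hne, ?_, fun k hk => ?_⟩
  · rw [Finset.lt_min'_iff]
    intro x hx
    simp only [Finset.mem_insert, Finset.mem_image, Finset.mem_Ico] at hx
    rcases hx with rfl | ⟨k, hk, rfl⟩
    · exact half_pos (norm_pos_iff.2 h0)
    · exact norm_pos_iff.2 (h k hk.1)
  · by_cases hkN : N ≤ k
    · exact (Finset.min'_le _ _ (Finset.mem_insert_self _ _)).trans (hN k hkN)
    · refine Finset.min'_le _ _ (Finset.mem_insert_of_mem (Finset.mem_image.2 ⟨k, ?_, rfl⟩))
      exact Finset.mem_Ico.2 ⟨hk, not_le.1 hkN⟩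

theorem formalDilation_coeff (a : ℂˣ) (f : LaurentSeries ℂ) (k : ℤ) :
    (formalDilation a f).coeff k = (a : ℂ) ^ k * f.coeff k := rfl

theorem eq_ofPowerSeries_of_coeff_neg {f : LaurentSeries ℂ} (h : ∀ k < 0, f.coeff k = 0) :
    f = HahnSeries.ofPowerSeries ℤ ℂ (PowerSeries.mk fun k => f.coeff k) := by
  ext k
  by_cases hk : k < 0
  · rw [h k hk, ofPowerSeries_coeff_of_neg _ hk]
  · obtain ⟨j, rfl⟩ := Int.eq_ofNat_of_zero_le (not_lt.1 hk)
    rw [HahnSeries.ofPowerSeries_apply_coeff, PowerSeries.coeff_mk]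

/-- A q-difference equation with coefficients regular at `0`, whose characteristic polynomial `P`
satisfies `P(0) ≠ 0`, `P(1) = 0` and has no root `p ^ k` with `k ≥ 1`, has a nonzero convergent
solution. -/
theorem exists_convergent_solution {p : ℂˣ} (hp : ‖(p : ℂ)‖ < 1) (s : Finset ℕ)
    (b : ℕ → ConvLaurent) (hb : ∀ i ∈ s, ∀ j < 0, (b i).1.coeff j = 0)
    {P : Polynomial ℂ} (hP : P = ∑ i ∈ s, Polynomial.monomial i ((b i).1.coeff 0))
    (h0 : P.eval 0 ≠ 0) (h1 : P.eval 1 = 0) (hk : ∀ k : ℕ, 0 < k → P.eval ((p : ℂ) ^ k) ≠ 0) :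
    ∃ f : ConvLaurent, f ≠ 0 ∧ ∑ i ∈ s, b i * dilation (p ^ i) f = 0 := by
  obtain ⟨A, R, hA, hR, hAR⟩ := exists_uniform_coeff_bound s b
  obtain ⟨δ, hδ, hPδ⟩ := exists_lower_bound hp h0 hk
  have hPev : ∀ x, P.eval x = ∑ i ∈ s, (b i).1.coeff 0 * x ^ i := fun x => by
    simp [hP, Polynomial.eval_finsetSum]
  -- For l ≤ k, `T k l` is the factor with which the l-th coefficient of f enters the k-th
  -- coefficient of the equation. The diagonal factor is P(p^k).
  set T : ℕ → ℕ → ℂ := fun k l => ∑ i ∈ s, (b i).1.coeff ((k - l : ℕ) : ℤ) * ((p : ℂ) ^ i) ^ l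
    with hT
  have hTdiag : ∀ k, T k k = P.eval ((p : ℂ) ^ k) := fun k => by
    simp only [hT, hPev, Nat.sub_self, Nat.cast_zero]
    exact Finset.sum_congr rfl fun i _ => by rw [← pow_mul, ← pow_mul, mul_comm i k]
  have hTle : ∀ k l, ‖T k l‖ ≤ s.card * A * R ^ (k - l) := fun k l => by
    refine (norm_sum_le _ _).trans ((Finset.sum_le_sum fun i hi => ?_).trans_eq
      (by rw [Finset.sum_const, nsmul_eq_mul, mul_assoc]))
    rw [norm_mul, norm_pow, norm_pow]
    exact (mul_le_of_le_one_right (norm_nonneg _)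
      (pow_le_one₀ (by positivity) (pow_le_one₀ (norm_nonneg _) hp.le))).trans (hAR i hi _)
  -- Solve the k-th coefficient equation for the k-th coefficient of f. The equation for k = 0 is
  -- P(1) = 0, which leaves the first coefficient free to be 1.
  set w : ℕ → ℕ → ℂ := fun k l => -(T k l) / P.eval ((p : ℂ) ^ k) with hw
  have hwle : ∀ k l, l < k → ‖w k l‖ ≤ (s.card * A / δ) * R ^ (k - l) := fun k l hl => by
    rw [hw, norm_div, norm_neg, div_mul_eq_mul_div]
    exact div_le_div₀ (by positivity) (hTle k l) hδ (hPδ k (by omega))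
  have hbound := norm_recursiveSeq_le (by positivity) hR hwle
  set F : PowerSeries ℂ := PowerSeries.mk (recursiveSeq w) with hF
  have hconv : IsConvergent (HahnSeries.ofPowerSeries ℤ ℂ F) :=
    IsConvergent.ofPowerSeries (A := 1) (B := R * (1 + s.card * A / δ)) fun k => by
      rw [hF, PowerSeries.coeff_mk, one_mul]
      exact hbound k
  refine ⟨⟨_, hconv⟩, fun h => ?_, ?_⟩
  · have h2 := congrArg (fun g : ConvLaurent => g.1.coeff ((0 : ℕ) : ℤ)) h
    simp only [HahnSeries.ofPowerSeries_apply_coeff, hF, PowerSeries.coeff_mk,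
      recursiveSeq_zero] at h2
    exact one_ne_zero h2
  · have hmul : ∀ i ∈ s, (b i * dilation (p ^ i) ⟨_, hconv⟩).1 = HahnSeries.ofPowerSeries ℤ ℂ
        (PowerSeries.mk (fun k => (b i).1.coeff k) *
          PowerSeries.mk fun k => ((p : ℂ) ^ i) ^ k * recursiveSeq w k) := by
      intro i hi
      rw [map_mul, ← eq_ofPowerSeries_of_coeff_neg (hb i hi)]
      change (b i).1 * formalDilation (p ^ i) _ = _
      congr 1
      ext k
      rw [formalDilation_coeff]
      by_cases hk0 : k < 0
      · rw [ofPowerSeries_coeff_of_neg _ hk0, ofPowerSeries_coeff_of_neg _ hk0, mul_zero]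
      · obtain ⟨j, rfl⟩ := Int.eq_ofNat_of_zero_le (not_lt.1 hk0)
        simp [HahnSeries.ofPowerSeries_apply_coeff, hF]
    refine Subtype.ext ?_
    have hval : (∑ i ∈ s, b i * dilation (p ^ i) ⟨_, hconv⟩).1 =
        ∑ i ∈ s, (b i * dilation (p ^ i) ⟨_, hconv⟩).1 := map_sum ConvLaurent.subtype _ _
    rw [hval, Finset.sum_congr rfl hmul, ← map_sum]
    refine (congrArg _ ?_).trans (map_zero (HahnSeries.ofPowerSeries ℤ ℂ))
    ext k
    rw [map_sum, map_zero]
    have hcoef : ∀ i ∈ s, PowerSeries.coeff k (PowerSeries.mk (fun k => (b i).1.coeff k) *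
          PowerSeries.mk fun k => ((p : ℂ) ^ i) ^ k * recursiveSeq w k) =
        ∑ l ∈ Finset.range (k + 1),
          (b i).1.coeff ((k - l : ℕ) : ℤ) * ((p : ℂ) ^ i) ^ l * recursiveSeq w l := by
      intro i _
      rw [mul_comm, PowerSeries.coeff_mul, Finset.Nat.sum_antidiagonal_eq_sum_range_succ_mk]
      refine Finset.sum_congr rfl fun l _ => ?_
      simp only [PowerSeries.coeff_mk]
      ring
    rw [Finset.sum_congr rfl hcoef, Finset.sum_comm]
    have hsum : ∀ l, ∑ i ∈ s, (b i).1.coeff ((k - l : ℕ) : ℤ) * ((p : ℂ) ^ i) ^ l *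
        recursiveSeq w l = T k l * recursiveSeq w l := fun l => by rw [hT, Finset.sum_mul]
    simp only [hsum]
    rw [Finset.sum_range_succ, hTdiag]
    rcases Nat.eq_zero_or_pos k with rfl | hkpos
    · simp [h1]
    · rw [recursiveSeq_of_pos w hkpos, Finset.mul_sum, ← Finset.sum_add_distrib]
      refine Finset.sum_eq_zero fun l _ => ?_
      have := hk k hkpos
      simp only [hw]
      field_simp
      ring

/-! ### Orders in `K_n` -/

theorem order_eq_of_coeff {f : LaurentSeries ℂ} {k : ℤ} (hk : f.coeff k ≠ 0)
    (h : ∀ j < k, f.coeff j = 0) : f.order = k := by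
  refine le_antisymm (HahnSeries.order_le_of_coeff_ne_zero hk) (not_lt.1 fun hlt => ?_)
  have hf : f ≠ 0 := by
    rintro rfl
    simp at hk
  exact HahnSeries.coeff_order_eq_zero.not.2 hf (h _ hlt)

theorem order_formalDilation (a : ℂˣ) (f : LaurentSeries ℂ) :
    (formalDilation a f).order = f.order := by
  by_cases hf : f = 0
  · simp [hf]
  refine order_eq_of_coeff ?_ fun j hj => ?_
  · rw [formalDilation_coeff]
    exact mul_ne_zero (zpow_ne_zero _ a.ne_zero) (HahnSeries.coeff_order_eq_zero.not.2 hf)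
  · rw [formalDilation_coeff, HahnSeries.coeff_eq_zero_of_lt_order hj, mul_zero]

theorem order_formalRamification (n : ℕ) [NeZero n] (f : LaurentSeries ℂ) :
    (formalRamification n f).order = n * f.order := by
  by_cases hf : f = 0
  · simp [hf]
  refine order_eq_of_coeff ?_ fun j hj => ?_
  · rw [formalRamification_coeff_mul]
    exact HahnSeries.coeff_order_eq_zero.not.2 hf
  · by_cases hd : (n : ℤ) ∣ j
    · obtain ⟨k, rfl⟩ := hd
      rw [formalRamification_coeff_mul]
      exact HahnSeries.coeff_eq_zero_of_lt_order
        (lt_of_mul_lt_mul_left hj (Nat.cast_nonneg n))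
    · exact formalRamification_coeff_of_not_dvd n f hd

namespace KRoot

variable {n : ℕ}

/-- The coefficient of `z^{k/n}` in an element of `K_n`. -/
def coeff (k : ℤ) : KRoot n →+ ℂ where
  toFun f := ((KRoot.equiv n).symm f).1.coeff k
  map_zero' := rfl
  map_add' _ _ := rfl

/-- The order of an element of `K_n` with respect to the variable `z^{1/n}`. -/
def ord (f : KRoot n) : ℤ := ((KRoot.equiv n).symm f).1.order

theorem ext_coeff {f g : KRoot n} (h : ∀ k, coeff k f = coeff k g) : f = g :=
  (KRoot.equiv n).symm.injective (Subtype.ext (HahnSeries.ext (funext h)))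

theorem coeff_ord_ne_zero {f : KRoot n} (hf : f ≠ 0) : coeff f.ord f ≠ 0 := by
  refine HahnSeries.coeff_order_eq_zero.not.2 fun h => hf ?_
  exact (KRoot.equiv n).symm.injective (Subtype.ext h)

theorem coeff_eq_zero_of_lt_ord {f : KRoot n} {k : ℤ} (h : k < f.ord) : coeff k f = 0 :=
  HahnSeries.coeff_eq_zero_of_lt_order h

theorem ord_mul {f g : KRoot n} (hf : f ≠ 0) (hg : g ≠ 0) : (f * g).ord = f.ord + g.ord := by
  refine HahnSeries.order_mul (x := ((KRoot.equiv n).symm f).1)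
    (y := ((KRoot.equiv n).symm g).1) (fun h => hf ?_) (fun h => hg ?_)
  · exact (KRoot.equiv n).symm.injective (Subtype.ext h)
  · exact (KRoot.equiv n).symm.injective (Subtype.ext h)

theorem coeff_rootMono_mul (t : ℤ) (c : ℂ) (f : KRoot n) (k : ℤ) :
    coeff k (rootMono n t c * f) = c * coeff (k - t) f := by
  have := HahnSeries.coeff_single_mul_add (r := c)
    (x := ((KRoot.equiv n).symm f).1) (a := k - t) (b := t)
  rw [sub_add_cancel] at this
  exact this

theorem rootMono_mul_rootMono (s t : ℤ) (a b : ℂ) :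
    rootMono n s a * rootMono n t b = rootMono n (s + t) (a * b) :=
  Subtype.ext HahnSeries.single_mul_single

theorem rootMono_ne_zero (t : ℤ) (c : ℂˣ) : rootMono n t c ≠ 0 := mono_ne_zero t c

theorem ord_rootMono (t : ℤ) (c : ℂˣ) : (rootMono n t c).ord = t :=
  HahnSeries.order_single c.ne_zero

theorem coeff_rootShift (τ : ℂ) (f : KRoot n) (k : ℤ) :
    coeff k (rootShift τ n f) = (qPow τ (1 / n) : ℂ) ^ k * coeff k f := rfl

theorem ord_rootShift (τ : ℂ) (f : KRoot n) : (rootShift τ n f).ord = f.ord :=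
  order_formalDilation _ _

theorem rootShift_rootMono (τ : ℂ) (t : ℤ) (c : ℂ) :
    rootShift τ n (rootMono n t c) = rootMono n t ((qPow τ (1 / n) : ℂ) ^ t * c) := by
  refine ext_coeff fun k => ?_
  rw [coeff_rootShift]
  change _ * (HahnSeries.single t c).coeff k = (HahnSeries.single t _).coeff k
  by_cases hk : k = t
  · subst hk
    simp
  · simp [HahnSeries.coeff_single_of_ne hk]

theorem coeff_algebraMap_mul [NeZero n] (a : ConvLaurent) (k : ℤ) :
    coeff (n * k) (algebraMap ConvLaurent (KRoot n) a) = a.1.coeff k :=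
  formalRamification_coeff_mul n a.1 k

theorem ord_algebraMap [NeZero n] (a : ConvLaurent) :
    (algebraMap ConvLaurent (KRoot n) a).ord = n * a.1.order :=
  order_formalRamification n a.1

theorem algebraMap_mono [NeZero n] (t : ℤ) (c : ℂ) :
    algebraMap ConvLaurent (KRoot n) (mono t c) = rootMono n (n * t) c := by
  refine ext_coeff fun k => ?_
  change (formalRamification n (HahnSeries.single t c)).coeff k = (HahnSeries.single _ c).coeff k
  by_cases hk : (n : ℤ) ∣ k
  · obtain ⟨j, rfl⟩ := hk
    rw [formalRamification_coeff_mul]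
    by_cases hj : j = t
    · subst hj
      simp
    · rw [HahnSeries.coeff_single_of_ne hj, HahnSeries.coeff_single_of_ne]
      exact fun h => hj (mul_left_cancel₀ (Nat.cast_ne_zero.2 (NeZero.ne n)) h)
  · rw [formalRamification_coeff_of_not_dvd n _ hk, HahnSeries.coeff_single_of_ne]
    rintro rfl
    exact hk (dvd_mul_right _ _)

/-- In a vanishing sum with a nonzero term, the minimal order is attained at least twice. -/
theorem exists_ord_eq_of_sum_eq_zero {ι : Type*} {s : Finset ι} {g : ι → KRoot n}
    (hsum : ∑ i ∈ s, g i = 0) (hne : ∃ i ∈ s, g i ≠ 0) :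
    ∃ i ∈ s, ∃ j ∈ s, i ≠ j ∧ g i ≠ 0 ∧ g j ≠ 0 ∧ (g i).ord = (g j).ord ∧
      ∀ k ∈ s, g k ≠ 0 → (g i).ord ≤ (g k).ord := by
  classical
  have hne' : (s.filter fun i => g i ≠ 0).Nonempty := by
    obtain ⟨i, hi, h⟩ := hne
    exact ⟨i, Finset.mem_filter.2 ⟨hi, h⟩⟩
  obtain ⟨i, hi, hmin⟩ := Finset.exists_min_image _ (fun i => (g i).ord) hne'
  rw [Finset.mem_filter] at hi
  have hmin' : ∀ k ∈ s, g k ≠ 0 → (g i).ord ≤ (g k).ord := fun k hk h =>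
    hmin k (Finset.mem_filter.2 ⟨hk, h⟩)
  by_contra! hcon
  have hc := congrArg (coeff (g i).ord) hsum
  rw [map_sum, map_zero, Finset.sum_eq_single i] at hc
  · exact coeff_ord_ne_zero hi.2 hc
  · intro j hj hji
    by_cases h0 : g j = 0
    · rw [h0, map_zero]
    refine coeff_eq_zero_of_lt_ord (lt_of_le_of_ne (hmin' j hj h0) fun h => ?_)
    obtain ⟨k, hk, hk0, hlt⟩ := hcon i hi.1 j hj hji.symm hi.2 h0 h
    exact (hmin' k hk hk0).not_gt hlt
  · exact fun h => absurd hi.1 h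

theorem sum_residuePart_smul [NeZero n] (f : ConvLaurent) :
    ∑ i : Fin n, residuePart n i f • rootMono n (i : ℕ) 1 = KRoot.equiv n f := by
  refine ext_coeff fun k => ?_
  rw [map_sum]
  have hterm : ∀ i : Fin n,
      coeff k (residuePart n i f • rootMono n (i : ℕ) 1) =
      (formalRamification n (residuePart n i f).1).coeff (k - (i : ℕ)) := by
    intro i
    rw [Algebra.smul_def, mul_comm, coeff_rootMono_mul, one_mul]
    rfl
  simp only [hterm]
  have hn : (0 : ℤ) < n := by exact_mod_cast NeZero.pos n
  have hm0 := Int.emod_nonneg k hn.ne'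
  have hm1 := Int.emod_lt_of_pos k hn
  set i₀ : Fin n := ⟨(k % n).toNat, by omega⟩ with hi₀
  have hi₀' : ((i₀ : ℕ) : ℤ) = k % n := by simp [hi₀, hm0]
  rw [Finset.sum_eq_single i₀]
  · have e : k - ((i₀ : ℕ) : ℤ) = n * (k / n) := by
      have := Int.mul_ediv_add_emod k n
      omega
    rw [e, formalRamification_coeff_mul]
    change f.1.coeff (n * (k / n) + ((i₀ : ℕ) : ℤ)) = _
    rw [← e, sub_add_cancel]
    rfl
  · intro i _ hi
    refine formalRamification_coeff_of_not_dvd n _ fun hd => hi (Fin.ext ?_)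
    have h1 : k % n = ((i : ℕ) : ℤ) % n := Int.emod_eq_emod_iff_emod_sub_eq_zero.2
      (Int.emod_eq_zero_of_dvd hd)
    have h2 : ((i : ℕ) : ℤ) % n = i := Int.emod_eq_of_lt (by positivity) (by exact_mod_cast i.2)
    rw [h2] at h1
    omega
  · simp

theorem finrank_le [NeZero n] : Module.finrank ConvLaurent (KRoot n) ≤ n := by
  have hsurj : Function.Surjective
      (Fintype.linearCombination ConvLaurent (fun i : Fin n => rootMono n (i : ℕ) 1)) := by
    intro f
    refine ⟨fun i => residuePart n i ((KRoot.equiv n).symm f), ?_⟩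
    rw [Fintype.linearCombination_apply, sum_residuePart_smul, RingEquiv.apply_symm_apply]
  simpa using LinearMap.finrank_le_finrank_of_surjective hsurj

end KRoot

/-! ### The modules `E(c z^{t/n})` -/

theorem qPow_one_div_pow {q : ℂˣ} {τ : ℂ}
    (hqτ : (q : ℂ) = Complex.exp (2 * Real.pi * Complex.I * τ)) (n : ℕ) [NeZero n] :
    (qPow τ (1 / n)) ^ n = q := by
  have hn : (n : ℂ) ≠ 0 := Nat.cast_ne_zero.2 (NeZero.ne n)
  ext
  rw [hqτ, Units.val_pow_eq_pow_val, qPow, Units.val_mk0, ← Complex.exp_nat_mul]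
  congr 1
  field_simp

theorem norm_qPow_one_div_pow {q : ℂˣ} {τ : ℂ}
    (hqτ : (q : ℂ) = Complex.exp (2 * Real.pi * Complex.I * τ)) (n : ℕ) [NeZero n] :
    ‖(qPow τ (1 / n) : ℂ)‖ ^ n = ‖(q : ℂ)‖ := by
  rw [← norm_pow, ← Units.val_pow_eq_pow_val, qPow_one_div_pow hqτ n]

theorem norm_qPow_one_div_lt_one {q : ℂˣ} (hq : ‖(q : ℂ)‖ < 1) {τ : ℂ}
    (hqτ : (q : ℂ) = Complex.exp (2 * Real.pi * Complex.I * τ)) (n : ℕ) [NeZero n] :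
    ‖(qPow τ (1 / n) : ℂ)‖ < 1 := by
  rw [← norm_qPow_one_div_pow hqτ n] at hq
  exact (pow_lt_one_iff_of_nonneg (norm_nonneg _) (NeZero.ne n)).1 hq

/-- The additive bijection `f ↦ c z^{t/n} φ(f)` of `K_n`, which is the operator `Φ` of
`E(c z^{t/n})`. -/
def twist (τ : ℂ) (n : ℕ) (t : ℤ) (c : ℂˣ) : KRoot n ≃+ KRoot n :=
  (rootShift τ n).toAddEquiv.trans (AddAut.mulRight
    (Units.mk0 (rootMono n t c) (mono_ne_zero t c)))

/-! ### The operator Φ on K_n and the orders of its iterates -/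

section twist

variable {τ : ℂ} {n : ℕ} {t : ℤ} {c : ℂˣ}

theorem twist_apply (f : KRoot n) :
    twist τ n t c f = rootMono n t c * rootShift τ n f :=
  mul_comm (rootShift τ n f) (rootMono n t c)

/-- The nonzero constant in `Φ ^ i e = const · z^{ti/n} e`. -/
def iterConst (τ : ℂ) (n : ℕ) (t : ℤ) (c : ℂˣ) (i : ℕ) : ℂˣ :=
  c ^ i * qPow τ (1 / n) ^ (t * (i.choose 2 : ℤ))

theorem twist_iterate (f : KRoot n) (i : ℕ) :
    (twist τ n t c)^[i] f =
      rootMono n (t * i) (iterConst τ n t c i) * (rootShift τ n)^[i] f := by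
  induction i with
  | zero =>
    refine KRoot.ext_coeff fun k => ?_
    rw [KRoot.coeff_rootMono_mul]
    simp [iterConst]
  | succ i ih =>
    rw [Function.iterate_succ_apply', ih, twist_apply, map_mul, KRoot.rootShift_rootMono, ← mul_assoc,
      KRoot.rootMono_mul_rootMono, Function.iterate_succ_apply']
    congr 2
    · push_cast
      ring
    · simp only [iterConst, Units.val_mul, Units.val_pow_eq_pow_val, Units.val_zpow_eq_zpow_val]
      rw [Nat.choose_succ_succ' i 1, Nat.choose_one_right]
      push_cast
      rw [mul_add, zpow_add₀ (Units.ne_zero _)]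
      ring

theorem twist_iterate_ne_zero {f : KRoot n} (hf : f ≠ 0) (i : ℕ) :
    ((twist τ n t c)^[i] f : KRoot n) ≠ 0 := by
  induction i with
  | zero => exact hf
  | succ i ih =>
    rw [Function.iterate_succ_apply']
    exact (map_ne_zero_iff _ (twist τ n t c).injective).2 ih

theorem ord_twist_iterate {f : KRoot n} (hf : f ≠ 0) (i : ℕ) :
    KRoot.ord ((twist τ n t c)^[i] f) = f.ord + t * i := by
  induction i with
  | zero => simp
  | succ i ih =>
    rw [Function.iterate_succ_apply', twist_apply, KRoot.ord_mul (KRoot.rootMono_ne_zero t c)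
      ((map_ne_zero_iff _ (rootShift τ n).injective).2 (twist_iterate_ne_zero hf i)),
      KRoot.ord_rootShift, ih, KRoot.ord_rootMono]
    push_cast
    ring

theorem coeff_rootShift_iterate (f : KRoot n) (i : ℕ) (k : ℤ) :
    KRoot.coeff k ((rootShift τ n)^[i] f) =
      ((qPow τ (1 / n) : ℂ) ^ i) ^ k * KRoot.coeff k f := by
  induction i with
  | zero => simp
  | succ i ih =>
    rw [Function.iterate_succ_apply', KRoot.coeff_rootShift, ih, pow_succ, mul_zpow]
    ring

variable [NeZero n]

theorem smul_twist_iterate_ne_zero {f : KRoot n} (hf : f ≠ 0) (i : ℕ) {a : ConvLaurent}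
    (ha : a ≠ 0) : (a • (twist τ n t c)^[i] f : KRoot n) ≠ 0 :=
  smul_ne_zero ha (twist_iterate_ne_zero hf i)

theorem ord_smul_twist_iterate {f : KRoot n} (hf : f ≠ 0) (i : ℕ) {a : ConvLaurent} (ha : a ≠ 0) :
    KRoot.ord (a • (twist τ n t c)^[i] f : KRoot n) =
      n * a.1.order + f.ord + t * i := by
  rw [Algebra.smul_def, KRoot.ord_mul
    ((map_ne_zero_iff _ (algebraMap ConvLaurent (KRoot n)).injective).2 ha)
    (twist_iterate_ne_zero hf i), KRoot.ord_algebraMap, ord_twist_iterate hf, add_assoc]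

/-- Coefficients from K contribute multiples of n to the order, so equal orders give t i ≡ t j mod
n, and t can be cancelled. -/
theorem dvd_sub_of_ord_smul_eq (ht : IsCoprime t (n : ℤ)) {f : KRoot n} (hf : f ≠ 0) {i j : ℕ}
    {a b : ConvLaurent} (ha : a ≠ 0) (hb : b ≠ 0)
    (h : KRoot.ord (a • (twist τ n t c)^[i] f : KRoot n) =
      KRoot.ord (b • (twist τ n t c)^[j] f : KRoot n)) :
    (n : ℤ) ∣ (i : ℤ) - j := by
  rw [ord_smul_twist_iterate hf i ha, ord_smul_twist_iterate hf j hb] at h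
  refine ht.symm.dvd_of_dvd_mul_left ⟨b.1.order - a.1.order, ?_⟩
  linear_combination h

/-- Two terms of a nontrivial relation would share the minimal order, so their indices, both in [0,
n), would be congruent mod n and hence equal. -/
theorem linearIndependent_twist_iterate (ht : IsCoprime t (n : ℤ)) {f : KRoot n} (hf : f ≠ 0) :
    LinearIndependent ConvLaurent
      (fun i : Fin n => ((twist τ n t c)^[(i : ℕ)] f : KRoot n)) := by
  rw [Fintype.linearIndependent_iff]
  intro a hsum
  by_contra! hne
  obtain ⟨i₀, hi₀⟩ := hne
  obtain ⟨i, -, j, -, hij, hi, hj, hord, -⟩ := KRoot.exists_ord_eq_of_sum_eq_zero hsum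
    ⟨i₀, Finset.mem_univ _, smul_twist_iterate_ne_zero hf _ hi₀⟩
  have hd := dvd_sub_of_ord_smul_eq ht hf (left_ne_zero_of_smul hi) (left_ne_zero_of_smul hj) hord
  refine hij (Fin.ext ?_)
  have h1 := i.2
  have h2 := j.2
  have := Int.eq_zero_of_abs_lt_dvd hd (by rw [abs_lt]; omega)
  omega

theorem finrank_KRoot : Module.finrank ConvLaurent (KRoot n) = n := by
  refine le_antisymm KRoot.finrank_le ?_
  have := (linearIndependent_twist_iterate (τ := 0) (c := 1) (n := n) (t := 1)
    isCoprime_one_left (one_ne_zero (α := KRoot n))).fintype_card_le_finrank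
  simpa using this

theorem span_twist_iterate (ht : IsCoprime t (n : ℤ)) {f : KRoot n} (hf : f ≠ 0) :
    Submodule.span ConvLaurent (Set.range
      (fun i : Fin n => ((twist τ n t c)^[(i : ℕ)] f : KRoot n))) = ⊤ :=
  (linearIndependent_twist_iterate ht hf).span_eq_top_of_card_eq_finrank'
    (by rw [finrank_KRoot, Fintype.card_fin])

/-- The power z^{tn/n} = z^t lies in K, so the coefficient of this n-step relation is a scalar of
the base field. -/
theorem twist_iterate_self (f : KRoot n) :
    ((twist τ n t c)^[n] f : KRoot n) =
      mono t (iterConst τ n t c n) • (rootShift τ n)^[n] f := by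
  rw [twist_iterate, Algebra.smul_def, KRoot.algebraMap_mono, mul_comm t]

end twist

section E

variable {q : ℂˣ} {τ : ℂ} {hqτ : (q : ℂ) = Complex.exp (2 * Real.pi * Complex.I * τ)}
  {n : ℕ} [NeZero n] {t : ℤ} {c : ℂˣ}

/-- A nonzero submodule contains some f ≠ 0 together with all Φ^i f, and the first n of these
already span K_n over K. -/
theorem E_isIrreducible (ht : IsCoprime t (n : ℤ)) : (E q τ hqτ n t c).IsIrreducible := by
  refine ⟨inferInstanceAs (Nontrivial (KRoot n)), fun N hN => or_iff_not_imp_left.2 fun hbot => ?_⟩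
  obtain ⟨f, hfN, hf⟩ := N.ne_bot_iff.1 hbot
  have hmem : ∀ i : ℕ, (E q τ hqτ n t c).Φ^[i] f ∈ N := fun i => by
    induction i with
    | zero => exact hfN
    | succ i ih =>
      rw [Function.iterate_succ_apply']
      exact (hN _).2 ih
  rw [eq_top_iff]
  refine (span_twist_iterate (τ := τ) (c := c) ht hf).ge.trans ?_
  refine (Submodule.span_le (p := (N : Submodule ConvLaurent (KRoot n)))).2 ?_
  rintro _ ⟨i, rfl⟩
  exact hmem i

/-! ### Isomorphisms between the modules `E(c z^{t/n})` -/

/-- Gauge transformation by m = z^{-k/n}: since φ(m) = p^{-k} m with p = q^{1/n}, multiplication by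
m turns c into c p^k. -/
theorem E_isomorphic_mul_zpow (k : ℤ) :
    (E q τ hqτ n t c).Isomorphic (E q τ hqτ n t (c * qPow τ (1 / n) ^ k)) := by
  let m : KRoot n := rootMono n (-k) 1
  have hm : m ≠ 0 := mono_ne_zero (-k) 1
  refine ⟨LinearEquiv.ofBijective (M := KRoot n) (M₂ := KRoot n)
    (LinearMap.mulLeft ConvLaurent m)
    ⟨mul_right_injective₀ hm, fun g => ⟨m⁻¹ * g, mul_inv_cancel_left₀ hm g⟩⟩, ?_⟩
  change ∀ f : KRoot n, m * twist τ n t c f = twist τ n t (c * qPow τ (1 / n) ^ k) (m * f)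
  intro f
  rw [twist_apply, twist_apply, map_mul, KRoot.rootShift_rootMono, ← mul_assoc, ← mul_assoc,
    KRoot.rootMono_mul_rootMono, KRoot.rootMono_mul_rootMono]
  congr 2
  · ring
  · simp only [Units.val_mul, Units.val_zpow_eq_zpow_val, mul_one, one_mul, mul_assoc]
    rw [← zpow_add₀ (Units.ne_zero _), add_neg_cancel, zpow_zero, mul_one]

/-- The `K`-automorphism `z^{1/n} ↦ ξ z^{1/n}` of `K_n`, for an `n`-th root of unity `ξ`. -/
def rootRotation (n : ℕ) [NeZero n] (ξ : ℂˣ) (hξ : ξ ^ n = 1) : KRoot n ≃ₐ[ConvLaurent] KRoot n :=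
  AlgEquiv.ofRingEquiv
    (f := ((KRoot.equiv n).symm.trans (dilation ξ)).trans (KRoot.equiv n)) fun a => by
    refine KRoot.ext_coeff fun k => ?_
    change (ξ : ℂ) ^ k * (formalRamification n a.1).coeff k = (formalRamification n a.1).coeff k
    by_cases hk : (n : ℤ) ∣ k
    · obtain ⟨j, rfl⟩ := hk
      rw [zpow_mul, zpow_natCast, ← Units.val_pow_eq_pow_val, hξ, Units.val_one, one_zpow, one_mul]
    · rw [formalRamification_coeff_of_not_dvd n _ hk, mul_zero]

theorem coeff_rootRotation (ξ : ℂˣ) (hξ : ξ ^ n = 1) (f : KRoot n) (k : ℤ) :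
    KRoot.coeff k (rootRotation n ξ hξ f) = (ξ : ℂ) ^ k * KRoot.coeff k f := rfl

/-- The rotation z^{1/n} ↦ ξ z^{1/n} commutes with φ and turns c₁ z^{t/n} into c₁ ξ^t z^{t/n}. From
a t + b n = 1, the n-th root of unity ξ = (c₂/c₁)^a satisfies ξ^t = c₂/c₁. -/
theorem E_isomorphic_of_pow_eq (ht : IsCoprime t (n : ℤ)) {c₁ c₂ : ℂˣ} (h : c₁ ^ n = c₂ ^ n) :
    (E q τ hqτ n t c₁).Isomorphic (E q τ hqτ n t c₂) := by
  obtain ⟨a, b, hab⟩ := ht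
  have hroot : (c₂ / c₁) ^ n = 1 := by rw [div_pow, h, div_self']
  have hξ : ((c₂ / c₁) ^ a) ^ n = 1 := by
    rw [← zpow_natCast, ← zpow_mul, mul_comm, zpow_mul, zpow_natCast, hroot, one_zpow]
  have hξt : ((c₂ / c₁) ^ a) ^ t = c₂ / c₁ := by
    rw [← zpow_mul, eq_sub_of_add_eq hab, zpow_sub, zpow_one, mul_comm b, zpow_mul, zpow_natCast,
      hroot, one_zpow, inv_one, mul_one]
  refine ⟨(rootRotation n _ hξ).toLinearEquiv, ?_⟩
  change ∀ f : KRoot n, rootRotation n _ hξ (twist τ n t c₁ f) =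
    twist τ n t c₂ (rootRotation n _ hξ f)
  refine fun f => KRoot.ext_coeff fun k => ?_
  rw [coeff_rootRotation, twist_apply, twist_apply, KRoot.coeff_rootMono_mul, KRoot.coeff_rootMono_mul,
    KRoot.coeff_rootShift, KRoot.coeff_rootShift, coeff_rootRotation]
  set ξ := (c₂ / c₁) ^ a
  have hc : (ξ : ℂ) ^ t * c₁ = c₂ := by
    rw [← Units.val_zpow_eq_zpow_val, hξt, ← Units.val_mul, div_mul_cancel]
  rw [← hc, zpow_sub₀ (Units.ne_zero ξ)]
  field_simp

theorem exists_zpow_mul_of_isomorphic {c₁ c₂ : ℂˣ}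
    (h : (E q τ hqτ n t c₁).Isomorphic (E q τ hqτ n t c₂)) :
    ∃ k : ℤ, q ^ k * c₂ ^ n = c₁ ^ n := by
  obtain ⟨e, he⟩ := h
  let one : (E q τ hqτ n t c₁).carrier := (1 : KRoot n)
  let f : KRoot n := e one
  have hf : f ≠ 0 := (map_ne_zero_iff _ e.injective).2 (one_ne_zero (α := KRoot n))
  have hiter : ∀ i (m : (E q τ hqτ n t c₁).carrier),
      e ((E q τ hqτ n t c₁).Φ^[i] m) = (E q τ hqτ n t c₂).Φ^[i] (e m) := fun i m => by
    induction i with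
    | zero => rfl
    | succ i ih => rw [Function.iterate_succ_apply', Function.iterate_succ_apply', he, ih]
  have h1 : mono t (iterConst τ n t c₁ n) • f =
      mono t (iterConst τ n t c₂ n) • (rootShift τ n)^[n] f := by
    rw [← twist_iterate_self]
    refine Eq.trans ?_ (hiter n one)
    have h2 : (E q τ hqτ n t c₁).Φ^[n] one = mono t (iterConst τ n t c₁ n) • one := by
      refine (twist_iterate_self (1 : KRoot n)).trans ?_
      rw [← RingEquiv.coe_toRingHom, ← RingHom.coe_pow, map_one]
      rfl
    rw [h2, map_smul]
    rfl
  -- Compare the lowest coefficients: φ^n multiplies the lowest coefficient of f by p^{n ord f} =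
  -- q^{ord f}. The powers of p in both `iterConst` factors agree and cancel, leaving c₁^n and c₂^n.
  have h3 := congrArg (KRoot.coeff (n * t + f.ord)) h1
  rw [Algebra.smul_def, Algebra.smul_def, KRoot.algebraMap_mono, KRoot.algebraMap_mono,
    KRoot.coeff_rootMono_mul, KRoot.coeff_rootMono_mul, add_sub_cancel_left,
    coeff_rootShift_iterate, ← mul_assoc] at h3
  have h4 := mul_right_cancel₀ (KRoot.coeff_ord_ne_zero hf) h3
  refine ⟨f.ord, ?_⟩
  rw [← Units.val_pow_eq_pow_val, qPow_one_div_pow hqτ, ← Units.val_zpow_eq_zpow_val,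
    ← Units.val_mul] at h4
  have h5 := Units.ext h4
  simp only [iterConst] at h5
  rw [mul_right_comm] at h5
  rw [mul_comm]
  exact (mul_right_cancel h5).symm

theorem E_isomorphic_iff (hq : ‖(q : ℂ)‖ < 1) {c₁ c₂ : ℂˣ} (h₁ : IsAdmissible q n t c₁)
    (h₂ : IsAdmissible q n t c₂) :
    (E q τ hqτ n t c₁).Isomorphic (E q τ hqτ n t c₂) ↔ c₁ ^ n = c₂ ^ n := by
  refine ⟨fun h => ?_, E_isomorphic_of_pow_eq h₁.1⟩
  obtain ⟨k, hk⟩ := exists_zpow_mul_of_isomorphic h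
  have hq0 : 0 < ‖(q : ℂ)‖ := norm_pos_iff.2 q.ne_zero
  have hbd : ∀ {c : ℂˣ}, IsAdmissible q n t c →
      ‖(q : ℂ)‖ < ‖(c : ℂ)‖ ^ n ∧ ‖(c : ℂ)‖ ^ n ≤ 1 := fun {c} hc => by
    refine ⟨?_, pow_le_one₀ (norm_nonneg _) hc.2.2⟩
    have := pow_lt_pow_left₀ hc.2.1 (by positivity) (NeZero.ne n)
    rwa [one_div, Real.rpow_inv_natCast_pow hq0.le (NeZero.ne n)] at this
  obtain ⟨ha, hb⟩ := hbd h₁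
  obtain ⟨ha', hb'⟩ := hbd h₂
  have hn : ‖(q : ℂ)‖ ^ k * ‖(c₂ : ℂ)‖ ^ n = ‖(c₁ : ℂ)‖ ^ n := by
    have := congrArg (fun u : ℂˣ => ‖(u : ℂ)‖) hk
    simpa using this
  -- Both |c₁|^n and |c₂|^n lie in (|q|, 1], a fundamental domain for multiplication by |q|.
  have hk0 : k = 0 := by
    refine le_antisymm (not_lt.1 fun hlt => ?_) (not_lt.1 fun hlt => ?_)
    · have : ‖(q : ℂ)‖ ^ k ≤ ‖(q : ℂ)‖ ^ (1 : ℤ) :=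
        zpow_le_zpow_right_of_le_one₀ hq0 hq.le (by omega)
      rw [zpow_one] at this
      nlinarith
    · have : ‖(q : ℂ)‖ ^ (-1 : ℤ) ≤ ‖(q : ℂ)‖ ^ k :=
        zpow_le_zpow_right_of_le_one₀ hq0 hq.le (by omega)
      rw [zpow_neg_one] at this
      have h2 : 1 < ‖(q : ℂ)‖⁻¹ * ‖(c₂ : ℂ)‖ ^ n := by
        rw [inv_mul_eq_div, one_lt_div hq0]
        exact ha'
      nlinarith
  rw [← hk, hk0, zpow_zero, one_mul]

end E

/-! ### Cyclic vectors and presentations by operators -/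

namespace DiffOp

variable {F : Type*} [Field F] {φ : F ≃+* F}

theorem induction {C : DiffOp φ → Prop} (x : DiffOp φ) (zero : C 0)
    (term : ∀ k a, C (DiffOp.term φ k a)) (add : ∀ x y, C x → C y → C (x + y)) : C x :=
  SkewMonoidAlgebra.induction_on x zero (fun g a => term g.toAdd a) add

theorem term_add (k : ℤ) (a b : F) : term φ k (a + b) = term φ k a + term φ k b :=
  SkewMonoidAlgebra.single_add _ _ _

theorem term_zero (k : ℤ) : term φ k 0 = 0 := SkewMonoidAlgebra.single_zero _

theorem one_eq_term : (1 : DiffOp φ) = term φ 0 1 := rfl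

/-- The coefficient of `Φ ^ k` in a difference operator. -/
def coeff (k : ℤ) : DiffOp φ →+ F where
  toFun x := SkewMonoidAlgebra.coeff x (Multiplicative.ofAdd k)
  map_zero' := rfl
  map_add' x y := DFunLike.congr_fun
    (SkewMonoidAlgebra.coeff_add (k := F) (G := Multiplicative ℤ) x y) _

theorem coeff_term (k l : ℤ) (a : F) : coeff k (term φ l a) = if l = k then a else 0 := by
  classical
  exact (SkewMonoidAlgebra.coeff_single_apply).trans (by simp)

theorem coeff_ofPolynomial_natCast (p : Polynomial F) (i : ℕ) :
    coeff (i : ℤ) (ofPolynomial φ p) = p.coeff i := by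
  simp only [ofPolynomial, map_sum, coeff_term, Nat.cast_inj, Finset.sum_ite_eq']
  split_ifs with h
  · rfl
  · exact (Polynomial.notMem_support_iff.1 h).symm

theorem coeff_ofPolynomial_eq_zero (p : Polynomial F) {k : ℤ} (hk : k < 0 ∨ p.natDegree < k) :
    coeff k (ofPolynomial φ p) = 0 := by
  rw [ofPolynomial, map_sum]
  refine Finset.sum_eq_zero fun i hi => ?_
  rw [coeff_term, if_neg]
  have := Polynomial.le_natDegree_of_mem_supp i hi
  omega

theorem ofPolynomial_eq_sum_range (p : Polynomial F) :
    ofPolynomial φ p = ∑ i ∈ Finset.range (p.natDegree + 1), term φ i (p.coeff i) := by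
  refine Finset.sum_subset (fun i hi => ?_) fun i _ hi => ?_
  · exact Finset.mem_range_succ_iff.2 (Polynomial.le_natDegree_of_mem_supp i hi)
  · rw [Polynomial.notMem_support_iff.1 hi, term_zero]

theorem exists_coeff_ne_zero {x : DiffOp φ} (hx : x ≠ 0) : ∃ k, coeff k x ≠ 0 := by
  by_contra! h
  exact hx (SkewMonoidAlgebra.ext fun g => h g.toAdd)

theorem finite_coeff_ne_zero (x : DiffOp φ) : {k | coeff k x ≠ 0}.Finite :=
  (SkewMonoidAlgebra.coeff x).hasFiniteSupport.preimage Multiplicative.ofAdd.injective.injOn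

theorem coeff_mul (x y : DiffOp φ) (s : Finset ℤ) (hs : ∀ k, coeff k x ≠ 0 → k ∈ s) (j : ℤ) :
    coeff j (x * y) = ∑ k ∈ s, coeff k x * (φ ^ k : RingAut F) (coeff (j - k) y) := by
  let _ := zAction φ
  have h := SkewMonoidAlgebra.coeff_mul_left (k := F) (G := Multiplicative ℤ) x y
    (Multiplicative.ofAdd j)
  refine h.trans ((SkewMonoidAlgebra.sum_def' (k := F) (G := Multiplicative ℤ) x _).trans ?_)
  refine (Finset.sum_subset (s₂ := s.map Multiplicative.ofAdd.toEmbedding) (fun g hg => ?_)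
    fun g _ hg => ?_).trans ?_
  · refine Finset.mem_map.2 ⟨g.toAdd, hs _ (SkewMonoidAlgebra.mem_support_iff.1 hg), rfl⟩
  · rw [SkewMonoidAlgebra.notMem_support_iff.1 hg, zero_mul]
  · rw [Finset.sum_map]
    refine Finset.sum_congr rfl fun k _ => ?_
    have : (Multiplicative.ofAdd k)⁻¹ * Multiplicative.ofAdd j = Multiplicative.ofAdd (j - k) := by
      rw [← ofAdd_neg, ← ofAdd_add]
      congr 1
      ring
    change _ * _ • SkewMonoidAlgebra.coeff y ((Multiplicative.ofAdd k)⁻¹ * _) = _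
    rw [this]
    rfl

/-- A left multiple of a monic operator `L` of degree `d` with nonzero constant term which has
degree less than `d` is zero. -/
theorem eq_zero_of_sum_mem_span {p : Polynomial F} (hp : p.Monic) (hp0 : p.coeff 0 ≠ 0)
    {b : Fin p.natDegree → F}
    (h : ∑ i, term φ (i.val : ℤ) (b i) ∈ Submodule.span (DiffOp φ) {ofPolynomial φ p}) : b = 0 := by
  obtain ⟨x, hx⟩ := Submodule.mem_span_singleton.1 h
  rw [smul_eq_mul] at hx
  have hcoeff : ∀ k : ℤ, (∀ i : Fin p.natDegree, ((i : ℕ) : ℤ) ≠ k) →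
      coeff k (x * ofPolynomial φ p) = 0 := fun k hk => by
    rw [hx, map_sum]
    exact Finset.sum_eq_zero fun i _ => by rw [coeff_term, if_neg (hk i)]
  have hx0 : x = 0 := by
    by_contra hne
    let s := (finite_coeff_ne_zero x).toFinset
    have hs : ∀ k, coeff k x ≠ 0 ↔ k ∈ s := fun k => by simp [s]
    have hsne : s.Nonempty := (exists_coeff_ne_zero hne).imp fun k => (hs k).1
    have hmul := coeff_mul x (ofPolynomial φ p) s fun k => (hs k).1
    -- Powers of Φ may be negative, so a degree bound alone does not exclude x ≠ 0. Both ends of x L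
    -- survive, the upper since L is monic and the lower since its constant term is nonzero. Their
    -- exponents are at least d apart, whereas exponents in [0, d) differ by less than d.
    have htop : coeff (s.max' hsne + p.natDegree) (x * ofPolynomial φ p) ≠ 0 := by
      rw [hmul, Finset.sum_eq_single (s.max' hsne)]
      · rw [add_sub_cancel_left, coeff_ofPolynomial_natCast, hp.coeff_natDegree, map_one, mul_one]
        exact (hs _).2 (s.max'_mem hsne)
      · intro k hk hkne
        rw [coeff_ofPolynomial_eq_zero, map_zero, mul_zero]
        have := lt_of_le_of_ne (s.le_max' k hk) hkne
        omega
      · exact fun h => absurd (s.max'_mem hsne) h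
    have hbot : coeff (s.min' hsne) (x * ofPolynomial φ p) ≠ 0 := by
      rw [hmul, Finset.sum_eq_single (s.min' hsne)]
      · rw [sub_self]
        refine mul_ne_zero ((hs _).2 (s.min'_mem hsne)) ?_
        rw [map_ne_zero_iff _ (RingEquiv.injective _)]
        exact (coeff_ofPolynomial_natCast p 0).trans_ne hp0
      · intro k hk hkne
        rw [coeff_ofPolynomial_eq_zero, map_zero, mul_zero]
        have := lt_of_le_of_ne (s.min'_le k hk) hkne.symm
        omega
      · exact fun h => absurd (s.min'_mem hsne) h
    have h1 : ∃ i : Fin p.natDegree, ((i : ℕ) : ℤ) = s.max' hsne + p.natDegree := by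
      by_contra! h
      exact htop (hcoeff _ h)
    have h2 : ∃ i : Fin p.natDegree, ((i : ℕ) : ℤ) = s.min' hsne := by
      by_contra! h
      exact hbot (hcoeff _ h)
    obtain ⟨i, hi⟩ := h1
    obtain ⟨j, hj⟩ := h2
    have h3 := s.min'_le_max' hsne
    have := i.2
    omega
  rw [hx0, zero_mul] at hx
  funext i
  have := congrArg (coeff ((i : ℕ) : ℤ)) hx
  rw [map_zero, map_sum, Finset.sum_eq_single i, coeff_term, if_pos rfl] at this
  · exact this.symm
  · intro j _ hj
    rw [coeff_term, if_neg]
    exact fun h => hj (Fin.ext (by exact_mod_cast h))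
  · simp

/-- The operators `∑ i < d, bᵢ Φ ^ i` form an additive group. -/
def lowDegree (φ : F ≃+* F) (d : ℕ) : (Fin d → F) →+ DiffOp φ where
  toFun b := ∑ i, term φ (i.val : ℤ) (b i)
  map_zero' := Finset.sum_eq_zero fun i _ => term_zero _
  map_add' b b' := by
    rw [← Finset.sum_add_distrib]
    exact Finset.sum_congr rfl fun i _ => term_add _ _ _

theorem lowDegree_apply (d : ℕ) (b : Fin d → F) :
    lowDegree φ d b = ∑ i, term φ (i.val : ℤ) (b i) := rfl

theorem term_mul_ofPolynomial (p : Polynomial F) (k : ℤ) (a : F) :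
    term φ k a * ofPolynomial φ p = ∑ i ∈ Finset.range (p.natDegree + 1),
      term φ (k + i) (a * (φ ^ k : RingAut F) (p.coeff i)) := by
  rw [ofPolynomial_eq_sum_range, Finset.mul_sum]
  exact Finset.sum_congr rfl fun i _ => term_mul_term φ _ _ _ _

/-- Division with remainder by a monic operator of degree `d` with nonzero constant term. -/
theorem exists_sub_lowDegree_mem_span {p : Polynomial F} (hp : p.Monic) (hp0 : p.coeff 0 ≠ 0)
    (x : DiffOp φ) : ∃ b, x - lowDegree φ p.natDegree b ∈
      Submodule.span (DiffOp φ) {ofPolynomial φ p} := by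
  set I := Submodule.span (DiffOp φ) {ofPolynomial φ p} with hI
  let V : AddSubgroup (DiffOp φ) := I.toAddSubgroup ⊔ (lowDegree φ p.natDegree).range
  have hL : ∀ k a, term φ k a * ofPolynomial φ p ∈ V := fun k a =>
    AddSubgroup.mem_sup_left (I.smul_mem (term φ k a) (Submodule.subset_span rfl))
  -- Nonnegative powers are lowered with the leading coefficient of L.
  have hnat : ∀ (k : ℕ) (a : F), term φ (k : ℤ) a ∈ V := fun k => by
    induction k using Nat.strong_induction_on with
    | _ k ih =>
      intro a
      by_cases hk : k < p.natDegree
      · refine AddSubgroup.mem_sup_right ⟨Pi.single ⟨k, hk⟩ a, ?_⟩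
        change ∑ i : Fin p.natDegree, term φ ((i : ℕ) : ℤ) (Pi.single (M := fun _ => F) ⟨k, hk⟩ a i) = _
        rw [Finset.sum_eq_single ⟨k, hk⟩, Pi.single_eq_same]
        · intro i _ hi
          rw [Pi.single_eq_of_ne hi, term_zero]
        · simp
      · obtain ⟨l, rfl⟩ := Nat.exists_eq_add_of_le' (not_lt.1 hk)
        have h := hL l a
        rw [term_mul_ofPolynomial, Finset.sum_range_succ, hp.coeff_natDegree, map_one, mul_one,
          add_comm] at h
        refine (add_mem_cancel_right ?_).1 (by push_cast; exact h)
        refine sum_mem fun i hi => ?_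
        have := Finset.mem_range.1 hi
        exact_mod_cast ih (l + i) (by omega) _
  -- Negative powers are raised with the constant coefficient, which can be inverted after the twist
  -- by φ^{-k}.
  have hneg : ∀ (k : ℕ) (a : F), term φ (-(k : ℤ)) a ∈ V := fun k => by
    induction k using Nat.strong_induction_on with
    | _ k ih =>
      intro a
      have hc : (φ ^ (-(k : ℤ)) : RingAut F) (p.coeff 0) ≠ 0 :=
        (map_ne_zero_iff _ (RingEquiv.injective _)).2 hp0
      have h := hL (-k) (a / (φ ^ (-(k : ℤ)) : RingAut F) (p.coeff 0))
      rw [term_mul_ofPolynomial, Finset.sum_range_succ', div_mul_cancel₀ _ hc, add_comm,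
        Nat.cast_zero, add_zero] at h
      refine (add_mem_cancel_right ?_).1 h
      refine sum_mem fun i _ => ?_
      by_cases hik : k ≤ i + 1
      · obtain ⟨l, hl⟩ := Nat.exists_eq_add_of_le hik
        have : -(k : ℤ) + ((i + 1 : ℕ) : ℤ) = (l : ℤ) := by omega
        rw [this]
        exact hnat _ _
      · have : -(k : ℤ) + ((i + 1 : ℕ) : ℤ) = -((k - (i + 1) : ℕ) : ℤ) := by omega
        rw [this]
        exact ih _ (by omega) _
  have hx : x ∈ V := by
    refine DiffOp.induction x V.zero_mem (fun k a => ?_) fun x y hx hy => V.add_mem hx hy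
    obtain ⟨l, rfl | rfl⟩ := k.eq_nat_or_neg
    · exact hnat l a
    · exact hneg l a
  obtain ⟨y, hy, _, ⟨b, rfl⟩, rfl⟩ := AddSubgroup.mem_sup.1 hx
  exact ⟨b, by simpa using hy⟩

end DiffOp

/-! ### Difference modules as left modules over the ring of operators -/

namespace DifferenceModule

variable {F : Type*} [Field F] {φ : F ≃+* F} (M : DifferenceModule.{u} φ)

/-- The integral powers of the operator `Φ`. -/
def iter (k : ℤ) : M.carrier → M.carrier := ((M.Φ.toEquiv : Equiv.Perm M.carrier) ^ k :)

theorem iter_zero (m : M.carrier) : M.iter 0 m = m := rfl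

theorem iter_one (m : M.carrier) : M.iter 1 m = M.Φ m := rfl

theorem iter_add (k l : ℤ) (m : M.carrier) : M.iter (k + l) m = M.iter k (M.iter l m) := by
  rw [iter, zpow_add]
  rfl

theorem iter_natCast (k : ℕ) (m : M.carrier) : M.iter k m = M.Φ^[k] m := by
  induction k with
  | zero => rfl
  | succ k ih =>
    rw [Function.iterate_succ_apply', ← ih, ← iter_one, ← iter_add, Nat.cast_succ, add_comm]

theorem iter_map_add (k : ℤ) (m m' : M.carrier) : M.iter k (m + m') = M.iter k m + M.iter k m' := by
  induction k with
  | zero => rfl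
  | succ k ih =>
    rw [add_comm, iter_add, ih, iter_add, iter_add, iter_one, iter_one, iter_one, map_add]
  | pred k ih =>
    have h : ∀ x, M.Φ (M.iter (-(k : ℤ) - 1) x) = M.iter (-k) x := fun x => by
      rw [← iter_one, ← iter_add, add_sub_cancel]
    refine M.Φ.injective ?_
    rw [map_add, h, h, h, ih]

theorem iter_smul (k : ℤ) (a : F) (m : M.carrier) :
    M.iter k (a • m) = (φ ^ k : RingAut F) a • M.iter k m := by
  induction k with
  | zero => rfl
  | succ k ih =>
    rw [add_comm, iter_add, ih, iter_add, iter_one, iter_one, Φ_smul, zpow_add, zpow_one]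
    rfl
  | pred k ih =>
    have h : ∀ x, M.Φ (M.iter (-(k : ℤ) - 1) x) = M.iter (-k) x := fun x => by
      rw [← iter_one, ← iter_add, add_sub_cancel]
    refine M.Φ.injective ?_
    rw [Φ_smul, h, h, ih]
    congr 1
    change _ = ((φ : RingAut F) * φ ^ (-(k : ℤ) - 1)) a
    rw [← zpow_one_add, add_sub_cancel]

/-- The action of a difference operator on a difference module, as a function of the operator. -/
def act (m : M.carrier) : DiffOp φ →+ M.carrier where
  toFun x := SkewMonoidAlgebra.sum (k := F) (G := Multiplicative ℤ) x
    fun k a => a • M.iter k.toAdd m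
  map_zero' := SkewMonoidAlgebra.sum_zero_index
  map_add' _ _ := SkewMonoidAlgebra.sum_add_index' (fun _ => zero_smul _ _)
    fun _ _ _ => add_smul _ _ _

theorem act_term (m : M.carrier) (k : ℤ) (a : F) :
    M.act m (DiffOp.term φ k a) = a • M.iter k m :=
  SkewMonoidAlgebra.sum_single_index (k := F) (G := Multiplicative ℤ) (a := .ofAdd k) (b := a)
    (h := fun k a => a • M.iter k.toAdd m) (zero_smul _ _)

theorem act_mul (m : M.carrier) (x y : DiffOp φ) : M.act m (x * y) = M.act (M.act m y) x := by
  induction x using DiffOp.induction with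
  | zero => simp
  | add x x' h h' => rw [add_mul, map_add, h, h', map_add]
  | term k a =>
    induction y using DiffOp.induction with
    | zero =>
      have : M.iter k 0 = 0 := by simpa using M.iter_map_add k 0 0
      rw [mul_zero, map_zero, act_term, this, smul_zero]
    | term l b =>
      rw [DiffOp.term_mul_term, act_term, act_term, act_term, iter_smul, mul_smul, iter_add]
    | add y y' h h' =>
      rw [mul_add, map_add, h, h', act_term, act_term, act_term, map_add, iter_map_add, smul_add]

theorem act_add (m m' : M.carrier) (x : DiffOp φ) :
    M.act (m + m') x = M.act m x + M.act m' x := by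
  induction x using DiffOp.induction with
  | zero => simp
  | term k a => rw [act_term, act_term, act_term, iter_map_add, smul_add]
  | add x y h h' =>
    rw [map_add, map_add, map_add, h, h']
    abel

theorem act_zero (x : DiffOp φ) : M.act 0 x = 0 := by
  simpa using M.act_add 0 0 x

/-- A difference module over `F` is a left module over the ring of difference operators. -/
@[reducible]
def diffOpModule : Module (DiffOp φ) M.carrier where
  smul x m := M.act m x
  one_smul m := by
    change M.act m 1 = m
    rw [DiffOp.one_eq_term, act_term, one_smul, iter_zero]
  mul_smul x y m := M.act_mul m x y
  smul_zero x := M.act_zero x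
  smul_add x m m' := M.act_add m m' x
  add_smul x y m := map_add (M.act m) x y
  zero_smul m := map_zero (M.act m)

theorem act_lowDegree (m : M.carrier) {d : ℕ} (b : Fin d → F) :
    M.act m (DiffOp.lowDegree φ d b) = ∑ i : Fin d, b i • M.Φ^[(i : ℕ)] m := by
  refine (map_sum (M.act m) _ _).trans (Finset.sum_congr rfl fun i _ => ?_)
  rw [act_term, iter_natCast]

theorem act_ofPolynomial (m : M.carrier) (p : Polynomial F) :
    M.act m (DiffOp.ofPolynomial φ p) =
      ∑ i ∈ Finset.range (p.natDegree + 1), p.coeff i • M.Φ^[i] m := by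
  rw [DiffOp.ofPolynomial_eq_sum_range, map_sum]
  exact Finset.sum_congr rfl fun i _ => by rw [act_term, iter_natCast]

/-- A difference module with a cyclic vector `m` is presented by a monic operator of degree equal
to the dimension which annihilates `m`. -/
theorem isPresentedBy_of_relation {p : Polynomial F} (hp : p.Monic) (hp0 : p.coeff 0 ≠ 0)
    {m : M.carrier} (hli : LinearIndependent F (fun i : Fin p.natDegree => M.Φ^[(i : ℕ)] m))
    (hspan : Submodule.span F (Set.range fun i : Fin p.natDegree => M.Φ^[(i : ℕ)] m) = ⊤)
    (hrel : ∑ i ∈ Finset.range (p.natDegree + 1), p.coeff i • M.Φ^[i] m = 0) :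
    M.IsPresentedBy (DiffOp.ofPolynomial φ p) := by
  let _ := M.diffOpModule
  let A : DiffOp φ →ₗ[DiffOp φ] M.carrier := LinearMap.toSpanSingleton (DiffOp φ) M.carrier m
  have hA : ∀ x, A x = M.act m x := fun x => rfl
  have hsurj : Function.Surjective A := fun y => by
    have hy : y ∈ Submodule.span F (Set.range fun i : Fin p.natDegree => M.Φ^[(i : ℕ)] m) :=
      hspan ▸ Submodule.mem_top
    obtain ⟨b, hb⟩ := (Submodule.mem_span_range_iff_exists_fun F).1 hy
    exact ⟨DiffOp.lowDegree φ _ b, (M.act_lowDegree m b).trans hb⟩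
  have hL : Submodule.span (DiffOp φ) {DiffOp.ofPolynomial φ p} ≤ LinearMap.ker A := by
    rw [Submodule.span_singleton_le_iff_mem, LinearMap.mem_ker, hA, act_ofPolynomial, hrel]
  -- Divide an annihilator of m by L: the remainder also kills m, and it is zero because m, …,
  -- Φ^{d-1} m are independent.
  have hker : Submodule.span (DiffOp φ) {DiffOp.ofPolynomial φ p} = LinearMap.ker A := by
    refine le_antisymm hL fun x hx => ?_
    obtain ⟨b, hb⟩ := DiffOp.exists_sub_lowDegree_mem_span (φ := φ) hp hp0 x
    have h1 := hL hb
    rw [LinearMap.mem_ker, map_sub, LinearMap.mem_ker.1 hx, zero_sub, neg_eq_zero, hA,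
      act_lowDegree] at h1
    have hb0 : b = 0 := funext (Fintype.linearIndependent_iff.1 hli b h1)
    rwa [hb0, map_zero, sub_zero] at hb
  let e : (DiffOp φ ⧸ Submodule.span (DiffOp φ) {DiffOp.ofPolynomial φ p}) ≃ₗ[DiffOp φ] M.carrier :=
    (Submodule.quotEquivOfEq _ _ hker).trans (A.quotKerEquivOfSurjective hsurj)
  refine ⟨e.toAddEquiv, fun f x => (map_smul e _ x).trans ?_, fun x => (map_smul e _ x).trans ?_⟩
  · exact (M.act_term _ _ _).trans (by rw [iter_zero]; rfl)
  · exact (M.act_term _ _ _).trans (by rw [iter_one, one_smul]; rfl)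

variable {M}

/-- A presentation by a monic operator `L` of degree `d` gives a cyclic vector `m` which is
annihilated by `L` and such that `m, Φ m, …, Φ ^ (d - 1) m` is a basis. -/
theorem IsPresentedBy.exists_cyclic {p : Polynomial F}
    (h : M.IsPresentedBy (DiffOp.ofPolynomial φ p)) (hp : p.Monic) (hp0 : p.coeff 0 ≠ 0) :
    ∃ m : M.carrier, LinearIndependent F (fun i : Fin p.natDegree => M.Φ^[(i : ℕ)] m) ∧
      Submodule.span F (Set.range fun i : Fin p.natDegree => M.Φ^[(i : ℕ)] m) = ⊤ ∧
      ∑ i ∈ Finset.range (p.natDegree + 1), p.coeff i • M.Φ^[i] m = 0 := by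
  unfold IsPresentedBy at h
  set I := Submodule.span (DiffOp φ) {DiffOp.ofPolynomial φ p} with hI
  obtain ⟨e, hsmul, hΦ⟩ := h
  have hiter : ∀ i : ℕ, e (I.mkQ (DiffOp.term φ i 1)) = M.Φ^[i] (e (I.mkQ 1)) := fun i => by
    induction i with
    | zero => rfl
    | succ i ih =>
      rw [Function.iterate_succ_apply', ← ih, ← hΦ, ← map_smul, smul_eq_mul,
        DiffOp.term_mul_term, map_one, mul_one, Nat.cast_succ, add_comm]
  have hterm : ∀ (i : ℕ) (a : F),
      e (I.mkQ (DiffOp.term φ i a)) = a • M.Φ^[i] (e (I.mkQ 1)) := fun i a => by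
    rw [← hiter, ← hsmul, ← map_smul, smul_eq_mul, DiffOp.term_mul_term, map_one, mul_one, zero_add]
  have hlow : ∀ b : Fin p.natDegree → F, e (I.mkQ (DiffOp.lowDegree φ _ b)) =
      ∑ i : Fin p.natDegree, b i • M.Φ^[(i : ℕ)] (e (I.mkQ 1)) := fun b => by
    rw [DiffOp.lowDegree_apply, map_sum, map_sum]
    exact Finset.sum_congr rfl fun i _ => hterm _ _
  refine ⟨e (I.mkQ 1), ?_, ?_, ?_⟩
  · rw [Fintype.linearIndependent_iff]
    intro b hb
    rw [← hlow, map_eq_zero_iff e e.injective, Submodule.mkQ_apply,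
      Submodule.Quotient.mk_eq_zero] at hb
    exact congrFun (DiffOp.eq_zero_of_sum_mem_span hp hp0 hb)
  · rw [eq_top_iff]
    intro y _
    obtain ⟨x, hx⟩ := I.mkQ_surjective (e.symm y)
    obtain ⟨b, hb⟩ := DiffOp.exists_sub_lowDegree_mem_span hp hp0 x
    rw [Submodule.mem_span_range_iff_exists_fun]
    refine ⟨b, ?_⟩
    have : I.mkQ x = I.mkQ (DiffOp.lowDegree φ _ b) := (Submodule.Quotient.eq I).2 hb
    rw [← hlow, ← this, hx, e.apply_symm_apply]
  · have h0 : I.mkQ (DiffOp.ofPolynomial φ p) = 0 :=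
      (Submodule.Quotient.mk_eq_zero I).2 (Submodule.subset_span rfl)
    have h1 := congrArg e h0
    rw [map_zero, DiffOp.ofPolynomial_eq_sum_range, map_sum, map_sum] at h1
    rw [← h1]
    exact Finset.sum_congr rfl fun i _ => (hterm _ _).symm

end DifferenceModule

/-! ### Newton polygons with a single slope -/

/-- A monic polynomial of degree `n` whose Newton polygon lies above the segment from `(0, t)` to
`(n, 0)`, with `t = v(a₀)`, has the only slope `t / n`. -/
theorem isNewtonSlope_iff {p : Polynomial ConvLaurent} (hp : p.Monic) {n : ℕ} (hn : 0 < n)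
    (hdeg : p.natDegree = n) {t : ℤ} (hp0 : p.coeff 0 ≠ 0) (ht : (p.coeff 0).1.order = t)
    (hle : ∀ i, p.coeff i ≠ 0 → (n : ℤ) * t ≤ n * (p.coeff i).1.order + t * i) (l : ℝ) :
    IsNewtonSlope p l ↔ l = t / n := by
  have hn' : (0 : ℝ) < n := by exact_mod_cast hn
  have hsub : newtonPolygon p ⊆
      {x | 0 ≤ x.1} ∩ {x | x.1 ≤ n} ∩ {x : ℝ × ℝ | (t : ℝ) ≤ x.2 + t / n * x.1} := by
    refine convexHull_min ?_ ?_
    · rintro x ⟨i, hi, hx1, hx2⟩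
      have hin : i ≤ n := hdeg ▸ Polynomial.le_natDegree_of_ne_zero hi
      refine ⟨⟨?_, ?_⟩, ?_⟩
      · simp [hx1]
      · simpa [hx1] using hin
      · have h1 : ((n : ℝ)) * t ≤ n * ((p.coeff i).1.order : ℤ) + t * i := by
          exact_mod_cast hle i hi
        have h2 : (t : ℝ) ≤ ((p.coeff i).1.order : ℤ) + t / n * i := by
          refine le_of_mul_le_mul_left (h1.trans_eq ?_) hn'
          field_simp
        change (t : ℝ) ≤ x.2 + t / n * x.1
        rw [hx1]
        linarith
    · have h1 : IsLinearMap ℝ (fun x : ℝ × ℝ => x.1) := ⟨fun _ _ => rfl, fun _ _ => rfl⟩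
      have h2 : IsLinearMap ℝ (fun x : ℝ × ℝ => x.2 + t / n * x.1) :=
        ⟨fun x y => by simp only [Prod.fst_add, Prod.snd_add]; ring,
          fun a x => by simp only [Prod.smul_fst, Prod.smul_snd, smul_eq_mul]; ring⟩
      exact ((convex_halfSpace_ge h1 0).inter (convex_halfSpace_le h1 n)).inter
        (convex_halfSpace_ge h2 t)
  have hleft : ((0 : ℝ), (t : ℝ)) ∈ newtonPolygon p :=
    subset_convexHull ℝ _ ⟨0, hp0, by simp, by simp [ht]⟩
  have hright : ((n : ℝ), (0 : ℝ)) ∈ newtonPolygon p := by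
    have h1 : p.coeff n = 1 := hdeg ▸ hp.coeff_natDegree
    refine subset_convexHull ℝ _ ⟨n, by simp [h1], rfl, ?_⟩
    rw [h1]
    simp
  constructor
  · rintro ⟨b, hb, x, ⟨hx, hxb⟩, y, ⟨hy, hyb⟩, hxy⟩
    have hb1 := hb _ hleft
    have hb2 := hb _ hright
    simp only [mul_zero, add_zero, zero_add] at hb1 hb2
    have hlin : ∀ x ∈ newtonPolygon p, x.2 + l * x.1 = b → t + (l - t / n) * x.1 ≤ b :=
      fun x hx hxb => by
        have := (hsub hx).2
        simp only [Set.mem_ofPred_eq] at this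
        rw [← hxb]
        linarith
    have htn : (t : ℝ) / n * n = t := div_mul_cancel₀ _ hn'.ne'
    rcases lt_trichotomy l (t / n) with hlt | heq | hgt
    -- If l ≠ t/n, the supporting line of slope parameter l touches the polygon only at an end
    -- vertex: at (n, 0) for l < t/n and at (0, t) for l > t/n. No edge lies on it.
    · have hfst : ∀ x ∈ newtonPolygon p, x.2 + l * x.1 = b → x.1 = n := fun x hx hxb => by
        have h1 := hlin x hx hxb
        have h2 := (hsub hx).1.2
        simp only [Set.mem_ofPred_eq] at h2
        nlinarith
      have h1 := hfst x hx hxb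
      have h2 := hfst y hy hyb
      refine absurd (Prod.ext (h1.trans h2.symm) ?_) hxy
      rw [h1] at hxb
      rw [h2] at hyb
      linarith
    · exact heq
    · have hfst : ∀ x ∈ newtonPolygon p, x.2 + l * x.1 = b → x.1 = 0 := fun x hx hxb => by
        have h1 := hlin x hx hxb
        have h2 := (hsub hx).1.1
        simp only [Set.mem_ofPred_eq] at h2
        nlinarith
      have h1 := hfst x hx hxb
      have h2 := hfst y hy hyb
      refine absurd (Prod.ext (h1.trans h2.symm) ?_) hxy
      rw [h1] at hxb
      rw [h2] at hyb
      linarith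
  · rintro rfl
    refine ⟨t, fun x hx => (hsub hx).2, _, ⟨hleft, by simp⟩, _, ⟨hright, ?_⟩, fun h => ?_⟩
    · simp only [zero_add]
      exact div_mul_cancel₀ _ hn'.ne'
    · exact hn'.ne (congrArg Prod.fst h)

/-! ### The slopes of the modules `E(c z^{t/n})` -/

section slopes

variable {q : ℂˣ} {τ : ℂ} {hqτ : (q : ℂ) = Complex.exp (2 * Real.pi * Complex.I * τ)}
  {n : ℕ} [NeZero n] {t : ℤ} {c : ℂˣ}

/-- A monic operator of degree `n` which annihilates a nonzero vector of `E(c z^{t/n})` has the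
only slope `t / n`. -/
theorem isNewtonSlope_iff_of_relation (ht : IsCoprime t (n : ℤ)) {p : Polynomial ConvLaurent}
    (hp : p.Monic) (hp0 : p.coeff 0 ≠ 0) (hdeg : p.natDegree = n) {f : KRoot n} (hf : f ≠ 0)
    (hrel : ∑ i ∈ Finset.range (n + 1), p.coeff i • (twist τ n t c)^[i] f = 0) (l : ℝ) :
    IsNewtonSlope p l ↔ l = t / n := by
  have hn : 0 < n := NeZero.pos n
  have hpn : p.coeff n = 1 := hdeg ▸ hp.coeff_natDegree
  have hg0 := smul_twist_iterate_ne_zero (τ := τ) (t := t) (c := c) hf 0 hp0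
  obtain ⟨i, hi, j, hj, hij, hi0, hj0, hord, hmin⟩ := KRoot.exists_ord_eq_of_sum_eq_zero hrel
    ⟨0, by simp, hg0⟩
  have hai := left_ne_zero_of_smul hi0
  have haj := left_ne_zero_of_smul hj0
  have hd := dvd_sub_of_ord_smul_eq ht hf hai haj hord
  rw [Finset.mem_range] at hi hj
  -- Distinct indices in [0, n] that are congruent mod n can only be the two ends. Equality of their
  -- orders then reads v(a₀) = t, and minimality places all other points on or above the edge.
  have hends : (i = 0 ∧ j = n) ∨ (i = n ∧ j = 0) := by
    obtain ⟨k, hk⟩ := hd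
    have hk1 : k < 2 := by nlinarith
    have hk2 : -2 < k := by nlinarith
    have hk0 : k ≠ 0 := by
      rintro rfl
      omega
    obtain rfl | rfl : k = 1 ∨ k = -1 := by omega
    · exact Or.inr (by omega)
    · exact Or.inl (by omega)
  rw [ord_smul_twist_iterate hf i hai] at hmin
  rw [ord_smul_twist_iterate hf i hai, ord_smul_twist_iterate hf j haj] at hord
  have hone : ((1 : ConvLaurent).1.order : ℤ) = 0 := HahnSeries.order_one
  have hn0 : (n : ℤ) ≠ 0 := by exact_mod_cast hn.ne'
  have ht0 : (p.coeff 0).1.order = t := by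
    refine mul_left_cancel₀ hn0 ?_
    rcases hends with ⟨rfl, rfl⟩ | ⟨rfl, rfl⟩
    · rw [hpn, hone] at hord
      push_cast at hord
      linarith
    · rw [hpn, hone] at hord
      push_cast at hord
      linarith
  refine isNewtonSlope_iff hp hn hdeg hp0 ht0 (fun k hk => ?_) l
  have hkn : k ≤ n := hdeg ▸ Polynomial.le_natDegree_of_ne_zero hk
  have h1 := hmin k (Finset.mem_range_succ_iff.2 hkn) (smul_twist_iterate_ne_zero hf k hk)
  rw [ord_smul_twist_iterate hf k hk] at h1
  rcases hends with ⟨rfl, rfl⟩ | ⟨rfl, rfl⟩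
  · rw [ht0] at h1
    push_cast at h1
    linarith
  · rw [hpn, hone] at h1
    linarith

/-- Any presentation gives a cyclic vector and a relation of degree dim_K K_n = n, to which the
order argument applies. A presentation exists since 1 is cyclic and Φ^n 1 = a · 1 with a a monomial
in K, so that L = Φ^n - a. -/
theorem E_slopes (ht : IsCoprime t (n : ℤ)) : (E q τ hqτ n t c).slopes = {(t : ℝ) / (n : ℝ)} := by
  have hn : 0 < n := NeZero.pos n
  refine Set.Subset.antisymm ?_ ?_
  · rintro l ⟨p, hp, hp0, hpres, hslope⟩
    obtain ⟨f, hli, hspan, hrel⟩ := hpres.exists_cyclic hp hp0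
    have hdeg : p.natDegree = n := by
      have := Module.finrank_eq_card_basis (Module.Basis.mk hli hspan.ge)
      rw [Fintype.card_fin] at this
      exact this.symm.trans finrank_KRoot
    have hf : f ≠ 0 := hli.ne_zero (⟨0, hdeg ▸ hn⟩ : Fin p.natDegree)
    rw [hdeg] at hrel
    exact (isNewtonSlope_iff_of_relation (c := c) ht hp hp0 hdeg hf hrel l).1 hslope
  · rintro _ rfl
    set a : ConvLaurent := mono t (iterConst τ n t c n) with ha
    let p : Polynomial ConvLaurent := Polynomial.X ^ n - Polynomial.C a
    have hp : p.Monic := Polynomial.monic_X_pow_sub_C a hn.ne'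
    have hdeg : p.natDegree = n := Polynomial.natDegree_X_pow_sub_C
    have hcoeff : ∀ i, p.coeff i = (if i = n then 1 else 0) - if i = 0 then a else 0 := fun i => by
      simp only [p, Polynomial.coeff_sub, Polynomial.coeff_X_pow, Polynomial.coeff_C]
    have hp0 : p.coeff 0 ≠ 0 := by
      rw [hcoeff, if_neg hn.ne, if_pos rfl, zero_sub, neg_ne_zero]
      exact mono_ne_zero _ _
    have hrel : ∑ i ∈ Finset.range (n + 1), p.coeff i • (twist τ n t c)^[i] (1 : KRoot n) = 0 := by
      simp only [hcoeff, sub_smul, ite_smul, one_smul, zero_smul, Finset.sum_sub_distrib,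
        Finset.sum_ite_eq', Finset.mem_range, Nat.lt_succ_self, Nat.succ_pos, if_true]
      rw [twist_iterate_self, ← RingEquiv.coe_toRingHom, ← RingHom.coe_pow, map_one]
      exact sub_self _
    have h1 : (1 : KRoot n) ≠ 0 := one_ne_zero
    refine ⟨p, hp, hp0, ?_, (isNewtonSlope_iff_of_relation (c := c) ht hp hp0 hdeg h1 hrel _).2 rfl⟩
    refine DifferenceModule.isPresentedBy_of_relation (E q τ hqτ n t c) hp hp0
      (m := (1 : KRoot n)) ?_ ?_ ?_
    · rw [hdeg]
      exact linearIndependent_twist_iterate ht h1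
    · rw [hdeg]
      exact span_twist_iterate ht h1
    · rw [hdeg]
      exact hrel

end slopes

/-! ### Irreducible difference modules -/

namespace DifferenceModule

variable {F : Type*} [Field F] {φ : F ≃+* F} {M : DifferenceModule.{u} φ}
  {N : DifferenceModule.{v} φ}

theorem Isomorphic.trans {P : DifferenceModule φ} (h : M.Isomorphic N) (h' : N.Isomorphic P) :
    M.Isomorphic P := by
  obtain ⟨e, he⟩ := h
  obtain ⟨e', he'⟩ := h'
  exact ⟨e.trans e', fun m => by simp [he, he']⟩

theorem Φ_symm_smul (a : F) (m : M.carrier) : M.Φ.symm (a • m) = φ.symm a • M.Φ.symm m := by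
  rw [AddEquiv.symm_apply_eq, Φ_smul, RingEquiv.apply_symm_apply, AddEquiv.apply_symm_apply]

/-- Schur's lemma: kernel and image are difference submodules. -/
theorem IsIrreducible.isomorphic_of_hom (hM : M.IsIrreducible) (hN : N.IsIrreducible)
    (h : M.carrier →ₗ[F] N.carrier) (hΦ : ∀ m, h (M.Φ m) = N.Φ (h m)) (h0 : h ≠ 0) :
    M.Isomorphic N := by
  have hker : LinearMap.ker h = ⊥ := by
    refine (hM.2 (LinearMap.ker h) fun m => ?_).resolve_right fun htop =>
      h0 (LinearMap.ker_eq_top.1 htop)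
    rw [LinearMap.mem_ker, LinearMap.mem_ker, hΦ, map_eq_zero_iff _ N.Φ.injective]
  have hrange : LinearMap.range h = ⊤ := by
    refine (hN.2 (LinearMap.range h) fun m => ?_).resolve_left fun hbot =>
      h0 (LinearMap.range_eq_bot.1 hbot)
    constructor
    · rintro ⟨x, hx⟩
      refine ⟨M.Φ.symm x, N.Φ.injective ?_⟩
      rw [← hΦ, AddEquiv.apply_symm_apply, hx]
    · rintro ⟨x, rfl⟩
      exact ⟨M.Φ x, hΦ x⟩
  exact ⟨LinearEquiv.ofBijective h ⟨LinearMap.ker_eq_bot.1 hker, LinearMap.range_eq_top.1 hrange⟩,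
    hΦ⟩

/-- A vector of `N` annihilated by an operator which presents `M` gives a homomorphism
`M → N`. -/
theorem exists_hom_of_relation {m : M.carrier} {d : ℕ} {a : ℕ → F} (had : a d = 1)
    (hli : LinearIndependent F (fun i : Fin d => M.Φ^[(i : ℕ)] m))
    (hspan : Submodule.span F (Set.range fun i : Fin d => M.Φ^[(i : ℕ)] m) = ⊤)
    (hrel : ∑ i ∈ Finset.range (d + 1), a i • M.Φ^[i] m = 0) {y : N.carrier}
    (hy : ∑ i ∈ Finset.range (d + 1), a i • N.Φ^[i] y = 0) :
    ∃ h : M.carrier →ₗ[F] N.carrier, (∀ x, h (M.Φ x) = N.Φ (h x)) ∧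
      ∀ i < d, h (M.Φ^[i] m) = N.Φ^[i] y := by
  let b := Module.Basis.mk hli hspan.ge
  let h : M.carrier →ₗ[F] N.carrier := b.constr F fun i : Fin d => N.Φ^[(i : ℕ)] y
  have hlt : ∀ i < d, h (M.Φ^[i] m) = N.Φ^[i] y := fun i hi => by
    have := b.constr_basis F (fun i : Fin d => N.Φ^[(i : ℕ)] y) ⟨i, hi⟩
    rwa [Module.Basis.mk_apply] at this
  -- Compatibility with Φ is automatic on all basis vectors but the last, where it is the common
  -- relation.
  have hd : h (M.Φ^[d] m) = N.Φ^[d] y := by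
    rw [Finset.sum_range_succ, had, one_smul] at hrel hy
    rw [eq_neg_of_add_eq_zero_right hrel, eq_neg_of_add_eq_zero_right hy, map_neg, map_sum]
    congr 1
    exact Finset.sum_congr rfl fun i hi => by rw [map_smul, hlt i (Finset.mem_range.1 hi)]
  refine ⟨h, fun x => ?_, hlt⟩
  have hx : x ∈ Submodule.span F (Set.range fun i : Fin d => M.Φ^[(i : ℕ)] m) :=
    hspan ▸ Submodule.mem_top
  induction hx using Submodule.span_induction with
  | mem x hx =>
    obtain ⟨i, rfl⟩ := hx
    simp only
    rw [hlt i i.2, ← Function.iterate_succ_apply' M.Φ, ← Function.iterate_succ_apply' N.Φ]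
    rcases Nat.lt_or_ge (i + 1) d with h1 | h1
    · exact hlt _ h1
    · have : (i : ℕ) + 1 = d := le_antisymm i.2 h1
      rw [Nat.succ_eq_add_one, this, hd]
  | zero => simp
  | add x y _ _ hx hy => rw [map_add, map_add, hx, hy, map_add, map_add]
  | smul a x _ hx => rw [Φ_smul, map_smul, hx, map_smul, Φ_smul]

/-- Every nonzero vector of an irreducible difference module is cyclic, and is annihilated by a
monic operator with nonzero constant term. -/
theorem IsIrreducible.exists_relation (hM : M.IsIrreducible) {m : M.carrier} (hm : m ≠ 0) :
    ∃ (d : ℕ) (a : ℕ → F), 0 < d ∧ a 0 ≠ 0 ∧ a d = 1 ∧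
      LinearIndependent F (fun i : Fin d => M.Φ^[(i : ℕ)] m) ∧
      Submodule.span F (Set.range fun i : Fin d => M.Φ^[(i : ℕ)] m) = ⊤ ∧
      ∑ i ∈ Finset.range (d + 1), a i • M.Φ^[i] m = 0 := by
  classical
  let W : ℕ → Submodule F M.carrier := fun d =>
    Submodule.span F (Set.range fun i : Fin d => M.Φ^[(i : ℕ)] m)
  have hli : ∀ d, (∀ k < d, M.Φ^[k] m ∉ W k) →
      LinearIndependent F (fun i : Fin d => M.Φ^[(i : ℕ)] m) := fun d => by
    induction d with
    | zero => exact fun _ => linearIndependent_empty_type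
    | succ d ih =>
      intro h
      rw [linearIndependent_finSucc']
      exact ⟨ih fun k hk => h k (hk.trans d.lt_succ_self), h d d.lt_succ_self⟩
  -- The least such d makes the earlier iterates independent and gives a monic relation of degree d.
  have hex : ∃ d, M.Φ^[d] m ∈ W d := by
    by_contra! h
    have := (hli (Module.finrank F M.carrier + 1) fun k _ => h k).fintype_card_le_finrank
    rw [Fintype.card_fin] at this
    omega
  have hmin : ∀ k < Nat.find hex, M.Φ^[k] m ∉ W k := fun k hk => Nat.find_min hex hk
  have hmem : M.Φ^[Nat.find hex] m ∈ W (Nat.find hex) := Nat.find_spec hex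
  obtain ⟨e, he⟩ : ∃ e, Nat.find hex = e + 1 := by
    refine Nat.exists_eq_succ_of_ne_zero fun h0 => hm ?_
    rw [h0] at hmem
    simpa [W] using hmem
  rw [he] at hmin hmem
  obtain ⟨b, hb⟩ := (Submodule.mem_span_range_iff_exists_fun F).1 hmem
  rw [Fin.sum_univ_succ] at hb
  have hmemW : ∀ k < e + 1, M.Φ^[k] m ∈ W (e + 1) := fun k hk =>
    Submodule.subset_span ⟨⟨k, hk⟩, rfl⟩
  -- Applying Φ⁻¹ to the relation shows Φ y = b₀ m. Minimality of e + 1 gives y ≠ 0, hence b₀ ≠ 0.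
  -- Thus Φ⁻¹ m is a multiple of y, and the span is stable under Φ⁻¹ as well as Φ.
  set y : M.carrier := M.Φ^[e] m - ∑ i : Fin e, φ.symm (b i.succ) • M.Φ^[(i : ℕ)] m with hy
  have hyW : y ∈ W (e + 1) := sub_mem (hmemW e e.lt_succ_self) (sum_mem fun i _ =>
    Submodule.smul_mem _ _ (hmemW i (i.2.trans e.lt_succ_self)))
  have hΦy : M.Φ y = b 0 • m := by
    rw [hy, map_sub, ← Function.iterate_succ_apply' M.Φ, map_sum, sub_eq_iff_eq_add,
      Nat.succ_eq_add_one, ← hb]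
    congr 1
    refine Finset.sum_congr rfl fun i _ => ?_
    rw [Φ_smul, RingEquiv.apply_symm_apply, ← Function.iterate_succ_apply' M.Φ]
    rfl
  have hb0 : b 0 ≠ 0 := fun h0 => by
    rw [h0, zero_smul, map_eq_zero_iff _ M.Φ.injective, hy, sub_eq_zero] at hΦy
    refine hmin e e.lt_succ_self ?_
    rw [hΦy]
    exact sum_mem fun i _ => Submodule.smul_mem _ _ (Submodule.subset_span ⟨i, rfl⟩)
  have hΦW : ∀ x ∈ W (e + 1), M.Φ x ∈ W (e + 1) := fun x hx => by
    induction hx using Submodule.span_induction with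
    | mem x hx =>
      obtain ⟨i, rfl⟩ := hx
      simp only
      rw [← Function.iterate_succ_apply' M.Φ]
      rcases Nat.lt_or_ge (i + 1) (e + 1) with h1 | h1
      · exact hmemW _ h1
      · have : (i : ℕ) + 1 = e + 1 := le_antisymm i.2 h1
        rw [Nat.succ_eq_add_one, this]
        exact hmem
    | zero => simp
    | add x y _ _ hx hy => exact map_add M.Φ x y ▸ add_mem hx hy
    | smul a x _ hx => exact M.Φ_smul a x ▸ Submodule.smul_mem _ _ hx
  have hΦsymmW : ∀ x ∈ W (e + 1), M.Φ.symm x ∈ W (e + 1) := fun x hx => by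
    induction hx using Submodule.span_induction with
    | mem x hx =>
      obtain ⟨⟨i, hi⟩, rfl⟩ := hx
      cases i with
      | zero =>
        have : M.Φ.symm m = φ.symm (b 0)⁻¹ • y := by
          rw [AddEquiv.symm_apply_eq, Φ_smul, RingEquiv.apply_symm_apply, hΦy,
            inv_smul_smul₀ hb0]
        exact this ▸ Submodule.smul_mem _ _ hyW
      | succ i =>
        simp only
        rw [Function.iterate_succ_apply', AddEquiv.symm_apply_apply]
        exact hmemW i (by omega)
    | zero => simp
    | add x y _ _ hx hy => exact map_add M.Φ.symm x y ▸ add_mem hx hy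
    | smul a x _ hx => exact Φ_symm_smul a x ▸ Submodule.smul_mem _ _ hx
  have htop : W (e + 1) = ⊤ := by
    refine (hM.2 (W (e + 1)) fun x => ⟨fun h => ?_, hΦW x⟩).resolve_left fun hbot => hm ?_
    · simpa using hΦsymmW _ h
    · have := hmemW 0 e.succ_pos
      rwa [hbot, Submodule.mem_bot] at this
  refine ⟨e + 1, fun i => if h : i < e + 1 then -b ⟨i, h⟩ else 1, e.succ_pos, ?_, ?_,
    hli _ hmin, htop, ?_⟩
  · simpa using hb0
  · simp
  · rw [Finset.sum_range_succ, Finset.sum_range]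
    simp only [lt_irrefl, dite_false, one_smul]
    rw [← Fin.sum_univ_succ (fun i : Fin (e + 1) => b i • M.Φ^[(i : ℕ)] m)] at hb
    rw [← hb, ← Finset.sum_add_distrib]
    refine Finset.sum_eq_zero fun i _ => ?_
    rw [dif_pos i.2, neg_smul, neg_add_cancel]

end DifferenceModule

/-! ### Every irreducible difference module over `K` is some `E(c z^{t/n})` -/

/-- For an operator `∑ aᵢ Φ ^ i` with `a₀ ≠ 0` of positive degree, the slope `t / n` of the edge of
the Newton polygon through `(0, v(a₀))`. -/
theorem exists_first_slope {d : ℕ} {a : ℕ → ConvLaurent} (hd : 0 < d) (had : a d ≠ 0) :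
    ∃ (n : ℕ) (_ : NeZero n) (t : ℤ), IsCoprime t (n : ℤ) ∧
      (∀ i ≤ d, a i ≠ 0 → (n : ℤ) * (a 0).1.order ≤ n * (a i).1.order + t * i) ∧
      ∃ i ≤ d, 0 < i ∧ a i ≠ 0 ∧ (n : ℤ) * (a 0).1.order = n * (a i).1.order + t * i := by
  classical
  let s := (Finset.range (d + 1)).filter fun i => 0 < i ∧ a i ≠ 0
  have hs : ∀ i, i ∈ s ↔ i ≤ d ∧ 0 < i ∧ a i ≠ 0 := fun i => by
    simp [s]
  -- These are the slopes, in the present sign convention, of the segments joining (0, v(a₀)) to (i,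
  -- v(a_i)). The first edge has the largest; its numerator and denominator are t and n.
  let g : ℕ → ℚ := fun i => (((a 0).1.order - (a i).1.order : ℤ) : ℚ) / i
  obtain ⟨i₀, hi₀, hmax⟩ := s.exists_max_image g ⟨d, (hs d).2 ⟨le_rfl, hd, had⟩⟩
  have hn : (0 : ℚ) < (g i₀).den := by exact_mod_cast (g i₀).den_pos
  have hg : g i₀ * (g i₀).den = (g i₀).num := Rat.mul_den_eq_num _
  refine ⟨(g i₀).den, ⟨(g i₀).den_nz⟩, (g i₀).num, ?_, fun i hi hai => ?_, i₀, ?_⟩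
  · rw [Int.isCoprime_iff_nat_coprime]
    exact (g i₀).reduced
  · rcases Nat.eq_zero_or_pos i with rfl | hi0
    · simp
    have h1 := hmax i ((hs i).2 ⟨hi, hi0, hai⟩)
    have hi' : (0 : ℚ) < i := by exact_mod_cast hi0
    have h2 : (((a 0).1.order - (a i).1.order : ℤ) : ℚ) ≤ g i₀ * i := (div_le_iff₀ hi').1 h1
    have h3 : (((g i₀).den : ℤ) : ℚ) * (((a 0).1.order - (a i).1.order : ℤ) : ℚ) ≤
        ((g i₀).num : ℚ) * i := by
      rw [← hg, Int.cast_natCast]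
      nlinarith
    have h4 : ((g i₀).den : ℤ) * ((a 0).1.order - (a i).1.order) ≤ (g i₀).num * i := by
      exact_mod_cast h3
    linarith
  · obtain ⟨h1, h2, h3⟩ := (hs i₀).1 hi₀
    refine ⟨h1, h2, h3, ?_⟩
    have hi' : (i₀ : ℚ) ≠ 0 := by exact_mod_cast h2.ne'
    have h5 : (((a 0).1.order - (a i₀).1.order : ℤ) : ℚ) = g i₀ * i₀ := (div_mul_cancel₀ _ hi').symm
    have h6 : (((g i₀).den : ℤ) : ℚ) * (((a 0).1.order - (a i₀).1.order : ℤ) : ℚ) =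
        ((g i₀).num : ℚ) * i₀ := by
      rw [← hg, Int.cast_natCast, h5]
      ring
    have h7 : ((g i₀).den : ℤ) * ((a 0).1.order - (a i₀).1.order) = (g i₀).num * i₀ := by
      exact_mod_cast h6
    linarith

/-- A complex polynomial of positive degree has a root of minimal modulus. -/
theorem exists_root_of_minimal_norm {P : Polynomial ℂ} (hP : 0 < P.degree) :
    ∃ c, P.eval c = 0 ∧ ∀ x, ‖x‖ < ‖c‖ → P.eval x ≠ 0 := by
  classical
  have hP0 : P ≠ 0 := by
    rintro rfl
    simp at hP
  obtain ⟨z, hz⟩ := Complex.exists_root hP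
  obtain ⟨c, hc, hmin⟩ := P.roots.toFinset.exists_min_image (fun x => ‖x‖)
    ⟨z, by simpa [hP0] using hz⟩
  simp only [Multiset.mem_toFinset, Polynomial.mem_roots hP0, Polynomial.IsRoot.def] at hc hmin
  exact ⟨c, hc, fun x hx h => (hmin x h).not_gt hx⟩

theorem rootShift_iterate (τ : ℂ) (n : ℕ) (f : KRoot n) (i : ℕ) :
    (rootShift τ n)^[i] f =
      KRoot.equiv n (dilation (qPow τ (1 / n) ^ i) ((KRoot.equiv n).symm f)) := by
  refine KRoot.ext_coeff fun k => ?_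
  rw [coeff_rootShift_iterate, ← Units.val_pow_eq_pow_val]
  rfl

/-- Every operator of positive degree with nonzero constant term annihilates a nonzero vector of
some `E(c z^{t/n})`, where `t / n` is the slope of the first edge of its Newton polygon. -/
theorem exists_twist_solution {q : ℂˣ} (hq : ‖(q : ℂ)‖ < 1) {τ : ℂ}
    (hqτ : (q : ℂ) = Complex.exp (2 * Real.pi * Complex.I * τ)) {d : ℕ} {a : ℕ → ConvLaurent}
    (hd : 0 < d) (ha0 : a 0 ≠ 0) (had : a d ≠ 0) :
    ∃ (n : ℕ) (_ : NeZero n) (t : ℤ) (c : ℂˣ) (f : KRoot n), IsCoprime t (n : ℤ) ∧ f ≠ 0 ∧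
      ∑ i ∈ Finset.range (d + 1), a i • (twist τ n t c)^[i] f = 0 := by
  obtain ⟨n, hn, t, ht, hle, i₀, hi₀d, hi₀, hai₀, heq⟩ := exists_first_slope (a := a) hd had
  set v := (a 0).1.order with hv
  let p : ℂˣ := qPow τ (1 / n)
  -- The coefficients of the twisted operator in K_n, divided by z^{v(a₀)}. The inequality for the
  -- first edge makes them regular at 0, with nonzero constant terms for i = 0 and i = i₀.
  let B : ℂˣ → ℕ → KRoot n := fun c i =>
    rootMono n (t * i - n * v) (iterConst τ n t c i) * algebraMap ConvLaurent (KRoot n) (a i)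
  have hB : ∀ c i k, KRoot.coeff k (B c i) = (iterConst τ n t c i : ℂ) *
      KRoot.coeff (k - (t * i - n * v)) (algebraMap ConvLaurent (KRoot n) (a i)) :=
    fun c i k => KRoot.coeff_rootMono_mul _ _ _ _
  have hBneg : ∀ c, ∀ i ∈ Finset.range (d + 1), ∀ k < 0, KRoot.coeff k (B c i) = 0 := by
    intro c i hi k hk
    rw [hB]
    by_cases hai : a i = 0
    · rw [hai, map_zero, map_zero, mul_zero]
    · rw [KRoot.coeff_eq_zero_of_lt_ord, mul_zero]
      rw [KRoot.ord_algebraMap]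
      have := hle i (Finset.mem_range_succ_iff.1 hi) hai
      linarith
  have hBzero : ∀ c i, a i ≠ 0 → (n : ℤ) * v = n * (a i).1.order + t * i →
      KRoot.coeff 0 (B c i) ≠ 0 := by
    intro c i hai h
    have hidx : 0 - (t * i - n * v) = n * (a i).1.order := by linarith
    rw [hB, hidx, KRoot.coeff_algebraMap_mul]
    exact mul_ne_zero (Units.ne_zero _) (HahnSeries.coeff_order_eq_zero.not.2
      fun h => hai (Subtype.ext h))
  have hBc : ∀ c i, KRoot.coeff 0 (B c i) = KRoot.coeff 0 (B 1 i) * (c : ℂ) ^ i := by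
    intro c i
    rw [hB, hB]
    simp only [iterConst, one_pow, one_mul, Units.val_mul, Units.val_pow_eq_pow_val]
    ring
  let P : ℂˣ → Polynomial ℂ := fun c =>
    ∑ i ∈ Finset.range (d + 1), Polynomial.monomial i (KRoot.coeff 0 (B c i))
  have hPeval : ∀ c x, (P c).eval x = (P 1).eval (c * x) := by
    intro c x
    simp only [P, Polynomial.eval_finsetSum, Polynomial.eval_monomial]
    exact Finset.sum_congr rfl fun i _ => by rw [hBc c i, mul_pow, mul_assoc]
  have hPcoeff : ∀ c, ∀ i ≤ d, (P c).coeff i = KRoot.coeff 0 (B c i) := by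
    intro c i hi
    simp only [P, Polynomial.finsetSum_coeff, Polynomial.coeff_monomial]
    rw [Finset.sum_ite_eq', if_pos (Finset.mem_range_succ_iff.2 hi)]
  have hP0 : ∀ c, (P c).eval 0 ≠ 0 := by
    intro c
    rw [← Polynomial.coeff_zero_eq_eval_zero, hPcoeff c 0 (Nat.zero_le d)]
    exact hBzero c 0 ha0 (by simp [hv])
  have hdeg : 0 < (P 1).degree := by
    refine lt_of_lt_of_le ?_ (Polynomial.le_degree_of_ne_zero (n := i₀) ?_)
    · exact_mod_cast hi₀
    · rw [hPcoeff 1 i₀ hi₀d]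
      exact hBzero 1 i₀ hai₀ heq
  -- Since P_c(x) = P_1(c x), this root gives P_c(1) = 0, and |c p^k| < |c| gives P_c(p^k) ≠ 0 for k
  -- ≥ 1.
  obtain ⟨c, hc, hcmin⟩ := exists_root_of_minimal_norm hdeg
  have hc0 : c ≠ 0 := by
    rintro rfl
    exact hP0 1 hc
  have hp : ‖(p : ℂ)‖ < 1 := norm_qPow_one_div_lt_one hq hqτ n
  let c' : ℂˣ := Units.mk0 c hc0
  obtain ⟨f, hf, hsol⟩ := exists_convergent_solution hp (Finset.range (d + 1))
    (fun i => (KRoot.equiv n).symm (B c' i)) (hBneg c') (P := P c') rfl (hP0 c')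
    (by rw [hPeval, mul_one]; exact hc) (fun k hk => by
      rw [hPeval]
      refine hcmin _ ?_
      rw [norm_mul, norm_pow]
      exact mul_lt_of_lt_one_right (norm_pos_iff.2 hc0)
        (pow_lt_one₀ (norm_nonneg _) hp hk.ne'))
  refine ⟨n, hn, t, c', KRoot.equiv n f, ht, (map_ne_zero_iff _ (KRoot.equiv n).injective).2 hf, ?_⟩
  have hterm : ∀ i, a i • (twist τ n t c')^[i] (KRoot.equiv n f) = rootMono n (n * v) 1 *
      KRoot.equiv n ((KRoot.equiv n).symm (B c' i) * dilation (p ^ i) f) := by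
    intro i
    rw [twist_iterate, rootShift_iterate, RingEquiv.symm_apply_apply, Algebra.smul_def, map_mul,
      RingEquiv.apply_symm_apply]
    have h1 : rootMono n (t * i) (iterConst τ n t c' i) =
        rootMono n (n * v) 1 * rootMono n (t * i - n * v) (iterConst τ n t c' i) := by
      rw [KRoot.rootMono_mul_rootMono, one_mul, add_sub_cancel]
    rw [h1]
    ring
  simp only [hterm]
  rw [← Finset.mul_sum, ← map_sum, hsol, map_zero, mul_zero]

theorem exists_isAdmissible_isomorphic {q : ℂˣ} (hq : ‖(q : ℂ)‖ < 1) {τ : ℂ}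
    (hqτ : (q : ℂ) = Complex.exp (2 * Real.pi * Complex.I * τ)) {n : ℕ} [NeZero n] {t : ℤ}
    (ht : IsCoprime t (n : ℤ)) (c : ℂˣ) :
    ∃ c' : ℂˣ, IsAdmissible q n t c' ∧ (E q τ hqτ n t c).Isomorphic (E q τ hqτ n t c') := by
  have hp := norm_qPow_one_div_lt_one hq hqτ n
  set p := qPow τ (1 / n) with hpdef
  have hp0 : 0 < ‖(p : ℂ)‖ := norm_pos_iff.2 p.ne_zero
  -- The half-open interval |p|^{-k} < |c| ≤ |p|^{-(k+1)} becomes |p| < |c p^{k+1}| ≤ 1, with the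
  -- strict inequality on the required side.
  obtain ⟨k, hk1, hk2⟩ := exists_mem_Ioc_zpow (norm_pos_iff.2 c.ne_zero)
    ((one_lt_inv₀ hp0).2 hp)
  refine ⟨c * p ^ (k + 1), ⟨ht, ?_, ?_⟩, E_isomorphic_mul_zpow _⟩
  · have hq' : ‖(q : ℂ)‖ ^ (1 / (n : ℝ)) = ‖(p : ℂ)‖ := by
      rw [← norm_qPow_one_div_pow hqτ n, ← hpdef, one_div,
        Real.pow_rpow_inv_natCast (norm_nonneg _) (NeZero.ne n)]
    rw [hq', Units.val_mul, Units.val_zpow_eq_zpow_val, norm_mul, norm_zpow]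
    rw [inv_zpow', zpow_neg] at hk1
    have h1 : 1 < ‖(c : ℂ)‖ * ‖(p : ℂ)‖ ^ k := (inv_lt_iff_one_lt_mul₀ (by positivity)).1 hk1
    rw [zpow_add_one₀ hp0.ne', ← mul_assoc]
    exact lt_mul_of_one_lt_left hp0 h1
  · rw [Units.val_mul, Units.val_zpow_eq_zpow_val, norm_mul, norm_zpow]
    rw [inv_zpow', zpow_neg] at hk2
    exact (le_inv_mul_iff₀' (by positivity)).1 (by rwa [mul_one])

/-- One nonzero solution of the operator of a cyclic vector is enough: irreducibility of both
modules turns the resulting nonzero homomorphism into an isomorphism, so no factorisation of the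
operator is needed. -/
theorem exists_isomorphic_E {q : ℂˣ} (hq : ‖(q : ℂ)‖ < 1) {τ : ℂ}
    (hqτ : (q : ℂ) = Complex.exp (2 * Real.pi * Complex.I * τ))
    {M : DifferenceModule.{u} (dilation q)} (hM : M.IsIrreducible) :
    ∃ (n : ℕ) (_ : NeZero n) (t : ℤ) (c : ℂˣ), IsAdmissible q n t c ∧
      M.Isomorphic (E q τ hqτ n t c) := by
  have := hM.1
  obtain ⟨m, hm⟩ := exists_ne (0 : M.carrier)
  obtain ⟨d, a, hd, ha0, had, hli, hspan, hrel⟩ := hM.exists_relation hm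
  obtain ⟨n, hn, t, c, f, ht, hf, hsol⟩ := exists_twist_solution hq hqτ hd ha0
    (had ▸ one_ne_zero)
  obtain ⟨h, hΦ, hh⟩ := DifferenceModule.exists_hom_of_relation (N := E q τ hqτ n t c) had hli
    hspan hrel (y := f) hsol
  have h0 : h ≠ 0 := by
    rintro rfl
    exact hf (hh 0 hd).symm
  obtain ⟨c', hc', hiso⟩ := exists_isAdmissible_isomorphic hq hqτ ht c
  exact ⟨n, hn, t, c', hc',
    (hM.isomorphic_of_hom (E_isIrreducible ht) h hΦ h0).trans hiso⟩

end QDiff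
end

theorem theorem3p4 (q : ℂˣ) (hq : ‖(q : ℂ)‖ < 1) (τ : ℂ) (hτ : 0 < τ.im)
    (hqτ : (q : ℂ) = Complex.exp (2 * Real.pi * Complex.I * τ)) :
    (∀ (n : ℕ) [NeZero n] (t : ℤ) (c : ℂˣ), QDiff.IsAdmissible q n t c →
      (QDiff.E q τ hqτ n t c).IsPure ∧ (QDiff.E q τ hqτ n t c).IsIrreducible ∧
        (QDiff.E q τ hqτ n t c).slopes = {(t : ℝ) / (n : ℝ)}) ∧
    (∀ (n : ℕ) [NeZero n] (t : ℤ) (c₁ c₂ : ℂˣ),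
      QDiff.IsAdmissible q n t c₁ → QDiff.IsAdmissible q n t c₂ →
        ((QDiff.E q τ hqτ n t c₁).Isomorphic (QDiff.E q τ hqτ n t c₂) ↔ c₁ ^ n = c₂ ^ n)) ∧
    (∀ M : QDiff.DifferenceModule.{u} (QDiff.dilation q), M.IsIrreducible →
      ∃ (n : ℕ) (_ : NeZero n) (t : ℤ) (c : ℂˣ), QDiff.IsAdmissible q n t c ∧
        M.Isomorphic (QDiff.E q τ hqτ n t c)) :=
  ⟨fun _ _ _ _ hadm => ⟨⟨_, QDiff.E_slopes hadm.1⟩, QDiff.E_isIrreducible hadm.1,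
      QDiff.E_slopes hadm.1⟩,
    fun _ _ _ _ _ h₁ h₂ => QDiff.E_isomorphic_iff hq h₁ h₂,
    fun _ hM => QDiff.exists_isomorphic_E hq hqτ hM⟩
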